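/- **Setting.** Consider $M$ subsystems $i\in\mathcal M=\{1,\dots,M\}$ with states $x_i\in\mathbb R^{n_i}$ and inputs $u_i\in\mathbb R^{m_i}$, a directed coupling graph $(\mathcal M,\mathcal E)$ without loops, neighborhoods $\mathcal N_i=\{j : (j,i)\in\mathcal E\}$, and a horizon $N$. The input constraint sets $\mathcal U_i$ are closed and convex. For each $i$ there are finitely many (at least one) convex polytopes $P_i^{(l)}$, $l\in\mathcal L_i=\{1,\dots,L_i\}$ (bounded intersections of finitely many closed half-spaces), with pairwise disjoint interiors and convex union $\mathcal X_i$. The dynamics are piecewise affine: $$x_i^+=f_i^{(l)}(x_i,u_i,\{x_j\}_{j\in\mathcal N_i}):=A_i^{(l)}x_i+B_i^{(l)}u_i+c_i^{(l)}+\sum_{j\in\mathcal N_i}A_{ij}^{(l)}x_j\quad\text{for an } l \text{ with } x_i\in P_i^{(l)};$$ where several regions contain $x_i$, the update of each of them is admissible. The coupled constraints $h_i(x_i,\{x_j\}_{j\in\mathcal N_i})\le 0$ are affine, the stage costs $\ell_i(x_i,u_i,\{x_j\}_{j\in\mathcal N_i})$ and terminal costs $V_{\mathrm f,i}(x_i)$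 are finite convex functions. Let $\mathbf x_i=(x_i(0),\dots,x_i(N))$, $\mathbf u_i=(u_i(0),\dots,u_i(N-1))$, let $\mathbf x_j^{(i)}$ be the local copy, held by $i$, of the trajectory of $j\in\mathcal N_i$, and put $\tilde{\mathbf x}_i=(\mathbf x_i,(\mathbf x_j^{(i)})_{j\in\mathcal N_i})$, $\mathbf y_i=(\tilde{\mathbf x}_i,\mathbf u_i)$, $\mathbf y=(\mathbf y_i)_i$, and $F_i(\mathbf y_i)=\sum_{k=0}^{N-1}\ell_i(x_i(k),u_i(k),\{x_j^{(i)}(k)\}_j)+V_{\mathrm f,i}(x_i(N))$. For a switching sequence $s_i\in\mathcal L_i^{N+1}$ and a state $x=(x_i)_i$ let * $\mathcal Y_i(x_i)$ be the set of $\mathbf y_i$ with $h_i(x_i(k),\{x_j^{(i)}(k)\}_j)\le 0$ and $x_i(k)\in\mathcal X_i$ for $0\le k\le N$, $u_i(k)\in\mathcal U_i$ for $0\le k<N$, and $x_i(0)=x_i$; * $\mathcal Y_i^{(s_i)}$ be the set of $\mathbf y_i$ with $x_i(k+1)=f_i^{(s_i(k))}(x_i(k),u_i(k),\{x_j^{(i)}(k)\}_j)$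 for $0\le k<N$ and $x_i(k)\in P_i^{(s_i(k))}$ for $0\le k\le N$; * $\mathcal Y_s(x)$, for $s=(s_i)_i$, be the set of $\mathbf y$ with $\mathbf y_i\in\mathcal Y_i(x_i)\cap\mathcal Y_i^{(s_i)}$ for all $i$ and $\mathbf x_j^{(i)}=\mathbf x_j$ for all $i$ and $j\in\mathcal N_i$; * $\mathcal Y(x)$, the feasible set of the distributed problem $\mathcal P_{\mathrm d}(x)$, be the set of $\mathbf y$ with $\mathbf y_i\in\mathcal Y_i(x_i)$ for all $i$, the piecewise affine dynamics (with neighbor states replaced by the copies), and $\mathbf x_j^{(i)}=\mathbf x_j$ for all $i$ and $j\in\mathcal N_i$. Let $\mathcal X_0$ be the set of states $x$ for which the centralized problem (the same constraints, without copies) is feasible, and let $r(\mathbf y)=\sum_i\sum_{j\in\mathcal N_i}\|\mathbf x_j^{(i)}-\mathbf x_j\|_2$. **Switching ADMM.** For $\rho>0$ and $T_{\mathrm{cut}}\in\mathbb N$, start from $x$ and a guess $\{\hat{\mathbf u}_i\}$. Roll the network out under the guess to get initial local copies. Let Eval-switching return, for given $x_i$, inputs and copies, all sequences obtained for $k=0,\dots,N$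 by choosing any $l$ with the current state in $\overline{P_i^{(l)}}$, setting $s_i(k)=l$ and, if $k<N$, updating the state with $f_i^{(l)}$ (if there is no such $l$, the initial dummy entry $1$ and the state are kept). Choose $s_i$ among the sequences returned for the guess, and set $\mathbf z_i=0$, $\boldsymbol\lambda_i=0$. For $\tau=0,1,2,\dots$ and all $i$, with $\tilde{\mathbf z}_i=(\mathbf z_i,(\mathbf z_j)_{j\in\mathcal N_i})$: $$\mathbf y_i^{\tau+1}\in\operatorname*{argmin}_{\mathbf y_i\in\mathcal Y_i(x_i)\cap\mathcal Y_i^{(s_i)}}F_i(\mathbf y_i)+(\boldsymbol\lambda_i^\tau)^\top\tilde{\mathbf x}_i+\tfrac\rho2\|\tilde{\mathbf x}_i-\tilde{\mathbf z}_i^\tau\|_2^2,$$ $\mathbf z_i^{\tau+1}$ is the average of $\mathbf x_i^{\tau+1}$ and of all copies $\mathbf x_i^{(j),\tau+1}$ of it (over the $j$ with $i\in\mathcal N_j$), and $\boldsymbol\lambda_i^{\tau+1}=\boldsymbol\lambda_i^\tau+\rho(\tilde{\mathbf x}_i^{\tau+1}-\tilde{\mathbf z}_i^{\tau+1})$. If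 $\tau<T_{\mathrm{cut}}$, then Eval-switching is applied to $x_i,\mathbf u_i^{\tau+1},\{\mathbf x_j^{(i),\tau+1}\}_j$, and $s_i$ is replaced by a returned sequence different from $s_i$ if there is one; otherwise $s_i$ is kept. The output after $T$ iterations is $\mathbf y^T$. The guess is *weakly feasible* for $x$ if the sequence $s$ generated from it in the initialization satisfies $\mathcal Y_s(x)\neq\emptyset$. **Proposition.** Assume that for no $x\in\mathcal X_0$ there is $s$ with $\mathcal Y_s(x)=\emptyset$ and $\mathcal Y_i(x_i)\cap\mathcal Y_i^{(s_i)}\ne\emptyset$ for all $i$. Let $x\in\mathcal X_0$, let $\{\hat{\mathbf u}_i\}$ be weakly feasible for $x$, and let $(\mathbf y^T)_{T\ge1}$ be the outputs of any run of the switching ADMM procedure. Then, as $T\to\infty$, the outputs converge to consensus and feasibility: 1. $r(\mathbf y^T)\to0$; 2. every limit point $\mathbf y^\star$ of $(\mathbf y^T)$ satisfies $r(\mathbf y^\star)=0$ and $\mathbf y^\star\in\mathcal Y(x)$; 3. if all $\mathcal U_i$ are bounded, then $\operatorname{dist}(\mathbf y^T,\mathcal Y(x))\to0$; 4. if all $\mathcal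 U_i$ are polytopes, then there is $\mathbf y^\star\in\mathcal Y(x)$ with $r(\mathbf y^\star)=0$ and $\tilde{\mathbf x}_i^T\to\tilde{\mathbf x}_i^\star$ for all $i$; if moreover every $\ell_i$ is strictly convex in $u_i$ on $\mathcal U_i$ (for fixed states), then $\mathbf y^\star$ can be chosen such that $\mathbf y^T\to\mathbf y^\star$. -/

import Mathlib

open Filter Topology

noncomputable section

/-- A convex polytope: a bounded intersection of finitely many closed half-spaces. -/
def IsPolytope {d : ℕ} (P : Set (EuclideanSpace ℝ (Fin d))) : Prop :=
  Bornology.IsBounded P ∧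
    ∃ (r : ℕ) (a : Fin r → EuclideanSpace ℝ (Fin d)) (b : Fin r → ℝ),
      P = {x | ∀ t, inner ℝ (a t) x ≤ b t}

/-- The neighborhood `N_i = {j | (j, i) ∈ E, i ≠ j}` of node `i` in a directed graph. -/
def nbrs {M : ℕ} (E : Finset (Fin M × Fin M)) (i : Fin M) : Finset (Fin M) :=
  Finset.univ.filter fun j => (j, i) ∈ E ∧ i ≠ j

/-- The data of a network of `M` coupled piecewise affine subsystems and of the finite-horizon
optimal control problem posed on it. -/
structure PWANetwork (M : ℕ) where
  /-- state, input and coupled-constraint dimensions, number of regions -/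
  n : Fin M → ℕ
  m : Fin M → ℕ
  q : Fin M → ℕ
  L : Fin M → ℕ
  L_pos : ∀ i, 0 < L i
  /-- directed coupling graph without loops -/
  E : Finset (Fin M × Fin M)
  E_irrefl : ∀ i, (i, i) ∉ E
  /-- the regions, with non-overlapping interiors and convex union (the state constraint set) -/
  P : ∀ i, Fin (L i) → Set (EuclideanSpace ℝ (Fin (n i)))
  P_polytope : ∀ i l, IsPolytope (P i l)
  P_disjoint : ∀ i l l', l ≠ l' → interior (P i l) ∩ interior (P i l') = ∅
  X_convex : ∀ i, Convex ℝ (⋃ l, P i l)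
  /-- the input constraint sets -/
  U : ∀ i, Set (EuclideanSpace ℝ (Fin (m i)))
  U_convex : ∀ i, Convex ℝ (U i)
  U_closed : ∀ i, IsClosed (U i)
  /-- the affine dynamics on each region -/
  A : ∀ i, Fin (L i) → EuclideanSpace ℝ (Fin (n i)) →ₗ[ℝ] EuclideanSpace ℝ (Fin (n i))
  B : ∀ i, Fin (L i) → EuclideanSpace ℝ (Fin (m i)) →ₗ[ℝ] EuclideanSpace ℝ (Fin (n i))
  c : ∀ i, Fin (L i) → EuclideanSpace ℝ (Fin (n i))
  Acpl : ∀ i, Fin (L i) → ∀ j : nbrs E i,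
    EuclideanSpace ℝ (Fin (n j)) →ₗ[ℝ] EuclideanSpace ℝ (Fin (n i))
  /-- the coupled constraint functions -/
  h : ∀ i, (EuclideanSpace ℝ (Fin (n i)) × (∀ j : nbrs E i, EuclideanSpace ℝ (Fin (n j))))
    →ᵃ[ℝ] (Fin (q i) → ℝ)
  /-- the stage and terminal costs -/
  stage : ∀ i, EuclideanSpace ℝ (Fin (n i)) × EuclideanSpace ℝ (Fin (m i)) ×
    (∀ j : nbrs E i, EuclideanSpace ℝ (Fin (n j))) → ℝ
  stage_convex : ∀ i, ConvexOn ℝ Set.univ (stage i)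
  Vf : ∀ i, EuclideanSpace ℝ (Fin (n i)) → ℝ
  Vf_convex : ∀ i, ConvexOn ℝ Set.univ (Vf i)

namespace PWANetwork

variable {M : ℕ}

/-- local states -/
abbrev St (S : PWANetwork M) (i : Fin M) : Type := EuclideanSpace ℝ (Fin (S.n i))

/-- local inputs -/
abbrev In (S : PWANetwork M) (i : Fin M) : Type := EuclideanSpace ℝ (Fin (S.m i))

/-- the neighborhood of subsystem `i`: the subsystems that affect `i` -/
abbrev Nb (S : PWANetwork M) (i : Fin M) : Finset (Fin M) := nbrs S.E i

/-- local state trajectories `x_i(0), …, x_i(N)` -/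
abbrev Traj (S : PWANetwork M) (N : ℕ) (i : Fin M) : Type := Fin (N + 1) → S.St i

/-- local copies, held by subsystem `i`, of the state trajectories of its neighbors -/
abbrev Copies (S : PWANetwork M) (N : ℕ) (i : Fin M) : Type := ∀ j : S.Nb i, S.Traj N j

/-- augmented state trajectories `(x_i, (x_j^{(i)})_{j ∈ N_i})` -/
abbrev Aug (S : PWANetwork M) (N : ℕ) (i : Fin M) : Type := S.Traj N i × S.Copies N i

/-- local input sequences `u_i(0), …, u_i(N-1)` -/
abbrev Inputs (S : PWANetwork M) (N : ℕ) (i : Fin M) : Type := Fin N → S.In i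

/-- local decision variables: an augmented state trajectory and an input sequence -/
abbrev Loc (S : PWANetwork M) (N : ℕ) (i : Fin M) : Type := S.Aug N i × S.Inputs N i

/-- global decision variables -/
abbrev Glob (S : PWANetwork M) (N : ℕ) : Type := ∀ i, S.Loc N i

/-- local switching sequences `s_i(0), …, s_i(N)` -/
abbrev SwSeq (S : PWANetwork M) (N : ℕ) (i : Fin M) : Type := Fin (N + 1) → Fin (S.L i)

/-- the state constraint set, partitioned by the regions -/
def X (S : PWANetwork M) (i : Fin M) : Set (S.St i) := ⋃ l, S.P i l

/-- the affine update map of region `l` of subsystem `i` -/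
def aff (S : PWANetwork M) (i : Fin M) (l : Fin (S.L i)) (x : S.St i) (u : S.In i)
    (w : ∀ j : S.Nb i, S.St j) : S.St i :=
  S.A i l x + S.B i l u + S.c i l + ∑ j, S.Acpl i l j (w j)

/-- The piecewise affine dynamics: `x⁺ = A^{(l)} x + B^{(l)} u + c^{(l)} + ∑ A_{ij}^{(l)} w_j` for a
region `P_i^{(l)}` that contains `x`. The regions are closed; on a common boundary of several
regions the update of each of them is admissible. -/
def IsNext (S : PWANetwork M) (i : Fin M) (x : S.St i) (u : S.In i)
    (w : ∀ j : S.Nb i, S.St j) (x' : S.St i) : Prop :=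
  ∃ l, x ∈ S.P i l ∧ x' = S.aff i l x u w

/-- the set of states for which the centralized problem is feasible -/
def X0 (S : PWANetwork M) (N : ℕ) : Set (∀ i, S.St i) :=
  {x | ∃ (X : ∀ i, S.Traj N i) (u : ∀ i, S.Inputs N i), ∀ i,
    (∀ k : Fin N,
      S.IsNext i (X i k.castSucc) (u i k) (fun j => X j k.castSucc) (X i k.succ)) ∧
    (∀ k : Fin (N + 1), S.h i (X i k, fun j => X j k) ≤ 0) ∧
    (∀ k : Fin (N + 1), X i k ∈ S.X i) ∧ (∀ k : Fin N, u i k ∈ S.U i) ∧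
    X i 0 = x i}

/-- the local cost `F_i` -/
def cost (S : PWANetwork M) {N : ℕ} (i : Fin M) (y : S.Loc N i) : ℝ :=
  (∑ k : Fin N, S.stage i (y.1.1 k.castSucc, y.2 k, fun j => y.1.2 j k.castSucc)) +
    S.Vf i (y.1.1 (Fin.last N))

/-- local constraints that do not involve the dynamics: the coupled constraints, the state and
input constraints, and the initial condition -/
def Yloc (S : PWANetwork M) (N : ℕ) (i : Fin M) (xi : S.St i) : Set (S.Loc N i) :=
  {y | (∀ k, S.h i (y.1.1 k, fun j => y.1.2 j k) ≤ 0) ∧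
    (∀ k, y.1.1 k ∈ S.X i) ∧ (∀ k, y.2 k ∈ S.U i) ∧ y.1.1 0 = xi}

/-- local constraints given by a switching sequence: the time-varying affine dynamics and
membership of the states in the selected regions -/
def Yseq (S : PWANetwork M) {N : ℕ} (i : Fin M) (s : S.SwSeq N i) : Set (S.Loc N i) :=
  {y | (∀ k : Fin N, y.1.1 k.succ =
      S.aff i (s k.castSucc) (y.1.1 k.castSucc) (y.2 k) (fun j => y.1.2 j k.castSucc)) ∧
    (∀ k, y.1.1 k ∈ S.P i (s k))}

/-- consistency of all local copies with the true trajectories -/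
def Consistent (S : PWANetwork M) {N : ℕ} (y : S.Glob N) : Prop :=
  ∀ i, ∀ j : S.Nb i, ∀ k, (y i).1.2 j k = (y j).1.1 k

/-- the feasible set `Y(x)` of the distributed problem `P_d(x)` -/
def Y (S : PWANetwork M) (N : ℕ) (x : ∀ i, S.St i) : Set (S.Glob N) :=
  {y | (∀ i, ∀ k : Fin N, S.IsNext i ((y i).1.1 k.castSucc) ((y i).2 k)
        (fun j => (y i).1.2 j k.castSucc) ((y i).1.1 k.succ)) ∧
    (∀ i, y i ∈ S.Yloc N i (x i)) ∧ S.Consistent y}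

/-- the feasible set `Y_s(x)` of the convex problem `P_s(x)` -/
def Ys (S : PWANetwork M) {N : ℕ} (s : ∀ i, S.SwSeq N i) (x : ∀ i, S.St i) :
    Set (S.Glob N) :=
  {y | (∀ i, y i ∈ S.Yloc N i (x i) ∩ S.Yseq i (s i)) ∧ S.Consistent y}

/-- No configuration of switching sequences is feasible for every subsystem locally and
infeasible globally, for any state for which the centralized problem is feasible. -/
def NoLocallyFeasibleTrap (S : PWANetwork M) (N : ℕ) : Prop :=
  ∀ x ∈ S.X0 N, ¬ ∃ s : ∀ i, S.SwSeq N i,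
    S.Ys s x = ∅ ∧ ∀ i, (S.Yloc N i (x i) ∩ S.Yseq i (s i)).Nonempty

/-- One pass of the loop over `k` in the evaluation of switching sequences: every pair
`(sequence, state)` branches over the regions whose closure contains the state; a pair whose state
is in none of them is kept as it is. -/
def evalStep (S : PWANetwork M) {N : ℕ} (i : Fin M) (u : S.Inputs N i) (w : S.Copies N i)
    (Φ : Set (S.SwSeq N i × S.St i)) (k : Fin (N + 1)) : Set (S.SwSeq N i × S.St i) :=
  {p | ∃ φ ∈ Φ,
    (∃ l, φ.2 ∈ closure (S.P i l) ∧
      p = (Function.update φ.1 k l,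
        if hk : (k : ℕ) < N then S.aff i l φ.2 (u ⟨k, hk⟩) (fun j => w j k) else φ.2)) ∨
    ((∀ l, φ.2 ∉ closure (S.P i l)) ∧ p = φ)}

/-- The set of switching sequences obtained by rolling out and branching the local dynamics for
`k = 0, …, N`, from a dummy sequence. -/
def evalSwitching (S : PWANetwork M) {N : ℕ} (i : Fin M) (xi : S.St i) (u : S.Inputs N i)
    (w : S.Copies N i) : Set (S.SwSeq N i) :=
  Prod.fst '' ((List.finRange (N + 1)).foldl (S.evalStep i u w)
    {((fun _ => ⟨0, S.L_pos i⟩ : S.SwSeq N i), xi)})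

/-- `X` is a state trajectory of the network from `x` under the inputs `u`. -/
def IsRollout (S : PWANetwork M) {N : ℕ} (x : ∀ i, S.St i) (u : ∀ i, S.Inputs N i)
    (X : ∀ i, S.Traj N i) : Prop :=
  ∀ i, X i 0 = x i ∧ ∀ k : Fin N,
    S.IsNext i (X i k.castSucc) (u i k) (fun j => X j k.castSucc) (X i k.succ)

/-- `s` is a global switching sequence that the initialization can select for the guess `u`: the
guess is rolled out to get the initial local copies, and `s_i` is chosen among the switching
sequences evaluated with these copies. -/
def Generates (S : PWANetwork M) {N : ℕ} (x : ∀ i, S.St i) (u : ∀ i, S.Inputs N i)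
    (s : ∀ i, S.SwSeq N i) : Prop :=
  ∃ X : ∀ i, S.Traj N i, S.IsRollout x u X ∧
    ∀ i, s i ∈ S.evalSwitching i (x i) (u i) (fun j => X j)

/-- The guess `u` is weakly feasible for `x`: the global switching sequence `s` generated from it
defines a feasible problem `P_s(x)`. -/
def WeaklyFeasible (S : PWANetwork M) {N : ℕ} (x : ∀ i, S.St i) (u : ∀ i, S.Inputs N i)
    (s : ∀ i, S.SwSeq N i) : Prop :=
  S.Generates x u s ∧ (S.Ys s x).Nonempty

/-- Euclidean inner product of augmented trajectories -/
def dot (S : PWANetwork M) {N : ℕ} (i : Fin M) (a b : S.Aug N i) : ℝ :=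
  (∑ k, inner ℝ (a.1 k) (b.1 k)) + ∑ j, ∑ k, inner ℝ (a.2 j k) (b.2 j k)

/-- the components of `z` that are relevant for subsystem `i` -/
def ztilde (S : PWANetwork M) {N : ℕ} (z : ∀ i, S.Traj N i) (i : Fin M) : S.Aug N i :=
  (z i, fun j => z j)

/-- the objective of the local minimization,
`F_i(y_i) + λ_iᵀ x̃_i + (ρ/2) ‖x̃_i - z̃_i‖²` -/
def augLagrangian (S : PWANetwork M) {N : ℕ} (ρ : ℝ) (i : Fin M) (z lam : S.Aug N i)
    (y : S.Loc N i) : ℝ :=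
  S.cost i y + S.dot i lam y.1 + ρ / 2 * S.dot i (y.1 - z) (y.1 - z)

/-- The average of `x_i` and of all the copies of it: those held by the subsystems `j` that have
`i` as a neighbor. -/
def average (S : PWANetwork M) {N : ℕ} (y : S.Glob N) (i : Fin M) : S.Traj N i :=
  let holders := Finset.univ.filter fun j => i ∈ S.Nb j
  ((holders.card : ℝ) + 1)⁻¹ •
    ((y i).1.1 + ∑ j : holders, (y j).1.2 ⟨i, (Finset.mem_filter.mp j.2).2⟩)

/-- `(y^τ, z^τ, λ^τ, s^τ)`, `τ = 0, 1, …`, is a run of the switching ADMM procedure with penalty `ρ`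
and cut-off `Tcut` from the state `x` and the guess `uhat`, without bound on the number of
iterations. The iterate `y^0` is not used. -/
structure IsRun (S : PWANetwork M) {N : ℕ} (ρ : ℝ) (Tcut : ℕ) (x : ∀ i, S.St i)
    (uhat : ∀ i, S.Inputs N i) (y : ℕ → S.Glob N) (z : ℕ → ∀ i, S.Traj N i)
    (lam : ℕ → ∀ i, S.Aug N i) (s : ℕ → ∀ i, S.SwSeq N i) : Prop where
  z_init : z 0 = 0
  lam_init : lam 0 = 0
  s_init : S.Generates x uhat (s 0)
  y_mem : ∀ τ i, y (τ + 1) i ∈ S.Yloc N i (x i) ∩ S.Yseq i (s τ i)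
  y_min : ∀ τ i, IsMinOn (S.augLagrangian ρ i (S.ztilde (z τ) i) (lam τ i))
    (S.Yloc N i (x i) ∩ S.Yseq i (s τ i)) (y (τ + 1) i)
  z_step : ∀ τ, z (τ + 1) = S.average (y (τ + 1))
  lam_step : ∀ τ i, lam (τ + 1) i =
    lam τ i + ρ • ((y (τ + 1) i).1 - S.ztilde (z (τ + 1)) i)
  s_switch : ∀ τ < Tcut, ∀ i,
    (S.evalSwitching i (x i) (y (τ + 1) i).2 (y (τ + 1) i).1.2 \ {s τ i}).Nonempty →
    s (τ + 1) i ∈ S.evalSwitching i (x i) (y (τ + 1) i).2 (y (τ + 1) i).1.2 \ {s τ i}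
  s_keep : ∀ τ < Tcut, ∀ i,
    S.evalSwitching i (x i) (y (τ + 1) i).2 (y (τ + 1) i).1.2 \ {s τ i} = ∅ →
    s (τ + 1) i = s τ i
  s_cut : ∀ τ, Tcut ≤ τ → ∀ i, s (τ + 1) i = s τ i

/-- the residual `∑_i ∑_{j ∈ N_i} ‖x_j^{(i)} - x_j‖₂` -/
def residual (S : PWANetwork M) {N : ℕ} (y : S.Glob N) : ℝ :=
  ∑ i, ∑ j : S.Nb i, √(∑ k, ‖(y i).1.2 j k - (y j).1.1 k‖ ^ 2)

end PWANetwork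

end

/-! From the cut-off on the switching sequences are frozen, and the procedure is consensus ADMM for
one convex problem: minimize the total cost over the locally feasible set `C` subject to `π y ∈ V`,
with `V` the consistent augmented trajectories. The averages are the orthogonal projection onto `V`,
so the multipliers stay in `Vᗮ`, even through the switching phase. The local feasible sets contain
the iterates, so the exclusion of locally feasible traps makes the frozen problem feasible.

For general closed convex inputs this problem may have neither a minimizer nor a multiplier, so
`ADMMRun.tendsto_residual` avoids both. The energy `‖z (k+1) - z k‖² + ‖π (y k) - z (k+1)‖²`
decreases, and its gaps dominate the squared second differences of `z`. Polytopic regions bound the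
states, hence `z`, so the increments of `z` vanish and the squared residual has a limit `δ`. If `δ >
0`, a dual value would grow by about `ρ * δ` per step, against weak duality at a feasible point.
Closedness of `C` then settles limit points, and compactness settles distances.

For polytopic inputs `C` is a polyhedron: Farkas' lemma gives a multiplier
(`IsPolyhedron.exists_isSaddle`), and Fejér monotonicity gives convergence of the augmented
trajectories and the multipliers. Strict convexity then determines the inputs from the trajectories
(`eq_of_strictConvex_stage`). -/

noncomputable section

/-! ### Convergence of ADMM, without and with a primal-dual solution -/

section ADMM

/-- A run of the alternating direction method of multipliers for the minimization of `F` over `C`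
subject to `π y ∈ V`, with the first minimization replaced by its optimality condition. -/
structure ADMMRun {H E : Type*} [NormedAddCommGroup H] [InnerProductSpace ℝ H]
    [NormedAddCommGroup E] [NormedSpace ℝ E] (π : E →L[ℝ] H) (V : Submodule ℝ H) (C : Set E)
    (F : E → ℝ) (ρ : ℝ) (y : ℕ → E) (z lam : ℕ → H) : Prop where
  mem : ∀ k, y k ∈ C
  z_mem : ∀ k, z k ∈ V
  lam_mem : ∀ k, lam k ∈ Vᗮ
  lam_step : ∀ k, lam (k + 1) = lam k + ρ • (π (y k) - z (k + 1))
  opt : ∀ k, ∀ v ∈ C,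
    F (y k) ≤ F v + inner ℝ (lam k + ρ • (π (y k) - z k)) (π v - π (y k))

/-- A primal-dual solution of the minimization of `F` over `C` subject to `π y ∈ V`. -/
structure IsSaddle {H E : Type*} [NormedAddCommGroup H] [InnerProductSpace ℝ H]
    [NormedAddCommGroup E] [NormedSpace ℝ E] (π : E →L[ℝ] H) (V : Submodule ℝ H) (C : Set E)
    (F : E → ℝ) (y : E) (lam : H) : Prop where
  mem : y ∈ C
  map_mem : π y ∈ V
  lam_mem : lam ∈ Vᗮ
  opt : ∀ v ∈ C, F y ≤ F v + inner ℝ lam (π v - π y)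

/-- A bounded sequence whose second differences tend to zero has first differences tending to
zero. -/
theorem tendsto_diff_zero_of_bounded {H : Type*} [NormedAddCommGroup H] [NormedSpace ℝ H]
    {z : ℕ → H} {R : ℝ} (hz : ∀ k, ‖z k‖ ≤ R)
    (h : Tendsto (fun k => (z (k + 2) - z (k + 1)) - (z (k + 1) - z k)) atTop (𝓝 0)) :
    Tendsto (fun k => z (k + 1) - z k) atTop (𝓝 0) := by
  have hR : 0 ≤ R := (norm_nonneg _).trans (hz 0)
  -- Over a window of fixed length `n` all increments agree asymptotically.
  have key : ∀ n : ℕ, Tendsto (fun k => (z (k + n) - z k) - (n : ℝ) • (z (k + 1) - z k))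
      atTop (𝓝 0) ∧ Tendsto (fun k => (z (k + n + 1) - z (k + n)) - (z (k + 1) - z k))
      atTop (𝓝 0) := by
    intro n
    induction n with
    | zero => simp
    | succ n ih =>
      obtain ⟨h1, h2⟩ := ih
      constructor
      · have := h1.add h2
        rw [add_zero] at this
        refine this.congr fun k => ?_
        push_cast
        rw [add_smul, one_smul, ← add_assoc]
        abel
      · have := h2.add (h.comp (tendsto_add_atTop_nat n))
        rw [add_zero] at this
        refine this.congr fun k => ?_
        simp only [Function.comp]
        rw [show k + (n + 1) + 1 = k + n + 2 by ring, show k + (n + 1) = k + n + 1 by ring]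
        abel
  rw [Metric.tendsto_atTop]
  intro ε hε
  -- `n` nearly equal increments add up to at most `2 * R`; the extra `1` absorbs the error from
  -- `key`.
  obtain ⟨n, hn⟩ := exists_nat_gt ((2 * R + 1) / ε)
  have hn0 : (0 : ℝ) < n := lt_of_le_of_lt (by positivity) hn
  obtain ⟨K, hK⟩ := (Metric.tendsto_atTop.1 (key n).1) 1 one_pos
  refine ⟨K, fun k hk => ?_⟩
  have h1 := hK k hk
  rw [dist_zero_right] at h1 ⊢
  have h2 : ‖(n : ℝ) • (z (k + 1) - z k)‖ ≤ ‖z (k + n) - z k‖ +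
      ‖(z (k + n) - z k) - (n : ℝ) • (z (k + 1) - z k)‖ := by
    have := norm_sub_le (z (k + n) - z k) ((z (k + n) - z k) - (n : ℝ) • (z (k + 1) - z k))
    rwa [sub_sub_cancel] at this
  have h3 : ‖z (k + n) - z k‖ ≤ R + R := (norm_sub_le _ _).trans (add_le_add (hz _) (hz _))
  rw [norm_smul, Real.norm_of_nonneg hn0.le] at h2
  rw [div_lt_iff₀ hε] at hn
  have : (n : ℝ) * ‖z (k + 1) - z k‖ < n * ε := by linarith
  exact lt_of_mul_lt_mul_left this hn0.le

/-- A real sequence with increments tending to a positive limit is not bounded above. -/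
theorem not_bddAbove_of_tendsto_diff_pos {q d : ℕ → ℝ} {δ R : ℝ} (hδ : 0 < δ)
    (hd : Tendsto d atTop (𝓝 δ)) (hq : ∀ k, q k + d k ≤ q (k + 1)) (hR : ∀ k, q k ≤ R) :
    False := by
  obtain ⟨K, hK⟩ := eventually_atTop.1 (hd.eventually (lt_mem_nhds (half_lt_self hδ)))
  have h : ∀ n : ℕ, q K + n * (δ / 2) ≤ q (K + n) := by
    intro n
    induction n with
    | zero => simp
    | succ n ih =>
      have h1 := hK (K + n) (by omega)
      have h2 := hq (K + n)
      rw [← add_assoc]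
      push_cast
      linarith
  obtain ⟨n, hn⟩ := exists_nat_gt ((R - q K) / (δ / 2))
  rw [div_lt_iff₀ (by positivity)] at hn
  linarith [h n, hR (K + n)]

namespace ADMMRun

variable {H E : Type*} [NormedAddCommGroup H] [InnerProductSpace ℝ H]
    [NormedAddCommGroup E] [NormedSpace ℝ E] {π : E →L[ℝ] H} {V : Submodule ℝ H} {C : Set E}
    {F : E → ℝ} {ρ : ℝ} {y : ℕ → E} {z lam : ℕ → H}

/-- The residual is `ρ⁻¹` times a difference of multipliers. Since `z (k + 1) ∈ V`, this makes `z (k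
+ 1)` the projection of `π (y k)`. -/
theorem residual_mem (h : ADMMRun π V C F ρ y z lam) (hρ : 0 < ρ) (k : ℕ) :
    π (y k) - z (k + 1) ∈ Vᗮ := by
  have h1 : ρ • (π (y k) - z (k + 1)) ∈ Vᗮ := by
    have := Vᗮ.sub_mem (h.lam_mem (k + 1)) (h.lam_mem k)
    rwa [h.lam_step, add_sub_cancel_left] at this
  exact (Vᗮ.smul_mem_iff hρ.ne').1 h1

/-- The price seen by the minimization is split into its `Vᗮ` part `lam (k + 1)` and its `V` part `ρ
• (z (k + 1) - z k)`; the later arguments rest on this orthogonality. -/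
theorem opt' (h : ADMMRun π V C F ρ y z lam) (k : ℕ) {v : E} (hv : v ∈ C) :
    F (y k) ≤ F v + inner ℝ (lam (k + 1) + ρ • (z (k + 1) - z k)) (π v - π (y k)) := by
  have h1 : lam (k + 1) + ρ • (z (k + 1) - z k) = lam k + ρ • (π (y k) - z k) := by
    rw [h.lam_step]
    simp only [smul_sub]
    abel
  rw [h1]
  exact h.opt k v hv

/-- Consecutive iterates are tested against each other and the two optimality conditions added.
Increments of `z` lie in `V` and residuals in `Vᗮ`, so mixed terms vanish and `⟪a', a' - a⟫ + ⟪b',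
b' - b⟫ ≤ 0` remains; polarization finishes. -/
theorem sq_norm_decrease (h : ADMMRun π V C F ρ y z lam) (hρ : 0 < ρ) (k : ℕ) :
    ‖z (k + 2) - z (k + 1)‖ ^ 2 + ‖π (y (k + 1)) - z (k + 2)‖ ^ 2 +
      (‖(z (k + 2) - z (k + 1)) - (z (k + 1) - z k)‖ ^ 2 +
        ‖(π (y (k + 1)) - z (k + 2)) - (π (y k) - z (k + 1))‖ ^ 2) ≤
      ‖z (k + 1) - z k‖ ^ 2 + ‖π (y k) - z (k + 1)‖ ^ 2 := by
  have o1 := h.opt' k (h.mem (k + 1))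
  have o2 := h.opt' (k + 1) (h.mem k)
  have e1 : π (y k) = z (k + 1) + (π (y k) - z (k + 1)) := by abel
  have e2 : π (y (k + 1)) = z (k + 2) + (π (y (k + 1)) - z (k + 2)) := by abel
  have hb1 := h.residual_mem hρ k
  have hb2 := h.residual_mem hρ (k + 1)
  have ha1 := V.sub_mem (h.z_mem (k + 1)) (h.z_mem k)
  have ha2 := V.sub_mem (h.z_mem (k + 2)) (h.z_mem (k + 1))
  have hl : lam (k + 2) = lam (k + 1) + ρ • (π (y (k + 1)) - z (k + 2)) := h.lam_step (k + 1)
  rw [show k + 1 + 1 = k + 2 from rfl] at o2 hb2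
  rw [hl] at o2
  have e3 : π (y (k + 1)) - π (y k) = (z (k + 2) - z (k + 1)) +
      ((π (y (k + 1)) - z (k + 2)) - (π (y k) - z (k + 1))) := by abel
  have e4 : π (y k) - π (y (k + 1)) = -((z (k + 2) - z (k + 1)) +
      ((π (y (k + 1)) - z (k + 2)) - (π (y k) - z (k + 1)))) := by abel
  rw [e3] at o1
  rw [e4] at o2
  set a := z (k + 1) - z k
  set a' := z (k + 2) - z (k + 1)
  set b := π (y k) - z (k + 1)
  set b' := π (y (k + 1)) - z (k + 2)
  have i1 : inner ℝ a b = 0 := (Submodule.mem_orthogonal V _).1 hb1 _ ha1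
  have i2 : inner ℝ a b' = 0 := (Submodule.mem_orthogonal V _).1 hb2 _ ha1
  have i3 : inner ℝ a' b = 0 := (Submodule.mem_orthogonal V _).1 hb1 _ ha2
  have i4 : inner ℝ a' b' = 0 := (Submodule.mem_orthogonal V _).1 hb2 _ ha2
  have i5 : inner ℝ b' a' = 0 := by rw [real_inner_comm]; exact i4
  rw [@norm_sub_sq_real _ _ _ a' a, @norm_sub_sq_real _ _ _ b' b]
  simp only [inner_add_left, inner_add_right, inner_sub_right, inner_smul_left, inner_neg_right,
    RCLike.conj_to_real, i1, i2, i3, i4, i5, real_inner_self_eq_norm_sq] at o1 o2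
  rw [real_inner_comm a' a] at o1
  have : ρ * (‖b'‖ ^ 2 - inner ℝ b' b + ‖a'‖ ^ 2 - inner ℝ a' a) ≤ 0 := by linarith
  have := nonpos_of_mul_nonpos_right this hρ
  linarith

/-- In a feasible problem with bounded consensus variables the primal residual and the increments
of the consensus variables tend to zero; no dual solution is needed. -/
theorem tendsto_residual (h : ADMMRun π V C F ρ y z lam) (hρ : 0 < ρ)
    (hV : ∀ R : ℝ, ∃ R' : ℝ, ∀ v ∈ C, ∀ w ∈ V, ‖π v - w‖ ≤ R → ‖w‖ ≤ R')
    {v : E} (hv : v ∈ C) (hvV : π v ∈ V) :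
    (∃ R, ∀ k, ‖z (k + 1)‖ ≤ R) ∧
    Tendsto (fun k => z (k + 2) - z (k + 1)) atTop (𝓝 0) ∧
      Tendsto (fun k => π (y k) - z (k + 1)) atTop (𝓝 0) := by
  set D : ℕ → ℝ := fun k => ‖z (k + 1) - z k‖ ^ 2 + ‖π (y k) - z (k + 1)‖ ^ 2 with hD
  have hdec := h.sq_norm_decrease hρ
  have hanti : Antitone D := antitone_nat_of_succ_le fun k => by
    have := hdec k
    simp only [hD]
    nlinarith [sq_nonneg ‖(z (k + 2) - z (k + 1)) - (z (k + 1) - z k)‖,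
      sq_nonneg ‖(π (y (k + 1)) - z (k + 2)) - (π (y k) - z (k + 1))‖]
  have hD0 : ∀ k, 0 ≤ D k := fun k => by positivity
  have hlim : Tendsto D atTop (𝓝 (⨅ k, D k)) :=
    tendsto_atTop_ciInf hanti ⟨0, by rintro _ ⟨k, rfl⟩; exact hD0 k⟩
  set δ := ⨅ k, D k
  have hgap : Tendsto (fun k => D k - D (k + 1)) atTop (𝓝 0) := by
    have := hlim.sub (hlim.comp (tendsto_add_atTop_nat 1))
    simpa using this
  have hda : Tendsto (fun k => (z (k + 2) - z (k + 1)) - (z (k + 1) - z k)) atTop (𝓝 0) := by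
    have h0 : Tendsto (fun k => ‖(z (k + 2) - z (k + 1)) - (z (k + 1) - z k)‖ ^ 2)
        atTop (𝓝 0) := squeeze_zero (fun k => sq_nonneg _) (fun k => by
          have := hdec k
          simp only [hD]
          nlinarith [sq_nonneg ‖(π (y (k + 1)) - z (k + 2)) - (π (y k) - z (k + 1))‖]) hgap
    have := h0.sqrt
    simp only [Real.sqrt_sq (norm_nonneg _), Real.sqrt_zero] at this
    exact tendsto_zero_iff_norm_tendsto_zero.2 this
  have hbb : ∀ k, ‖π (y k) - z (k + 1)‖ ≤ √(D 0) := fun k => by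
    apply Real.le_sqrt_of_sq_le
    have := hanti (Nat.zero_le k)
    simp only [hD] at this ⊢
    nlinarith [sq_nonneg ‖z (k + 1) - z k‖]
  -- The energy bounds every residual by `√(D 0)`, which is what the boundedness hypothesis needs.
  obtain ⟨R, hR⟩ := hV √(D 0)
  have hzR : ∀ k, ‖z (k + 1)‖ ≤ R := fun k => hR _ (h.mem k) _ (h.z_mem _) (hbb k)
  have ha : Tendsto (fun k => z (k + 2) - z (k + 1)) atTop (𝓝 0) :=
    tendsto_diff_zero_of_bounded (z := fun k => z (k + 1)) hzR
      (hda.comp (tendsto_add_atTop_nat 1))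
  have ha0 : Tendsto (fun k => z (k + 1) - z k) atTop (𝓝 0) :=
    (tendsto_add_atTop_iff_nat (f := fun k => z (k + 1) - z k) 1).1 ha
  -- The increments carry no energy in the limit, so the residual carries all of `δ`.
  have hb2 : Tendsto (fun k => ‖π (y k) - z (k + 1)‖ ^ 2) atTop (𝓝 δ) := by
    have := hlim.sub (ha0.norm.pow 2)
    simpa [hD] using this
  refine ⟨⟨R, hzR⟩, ha, ?_⟩
  have hδ0 : 0 ≤ δ := ge_of_tendsto' hb2 fun k => sq_nonneg _
  rcases hδ0.eq_or_lt with hδ | hδ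
  · rw [← hδ] at hb2
    have := hb2.sqrt
    simp only [Real.sqrt_sq (norm_nonneg _), Real.sqrt_zero] at this
    exact tendsto_zero_iff_norm_tendsto_zero.2 this
  exfalso
  -- The dual value is bounded above by weak duality, but its increments tend to `ρ * δ`
  set q : ℕ → ℝ := fun k => F (y k) + inner ℝ (lam (k + 1) + ρ • (z (k + 1) - z k)) (π (y k))
    with hq
  set d : ℕ → ℝ := fun k => ρ * (‖π (y (k + 1)) - z (k + 2)‖ ^ 2 +
    inner ℝ ((z (k + 2) - z (k + 1)) - (z (k + 1) - z k)) (z (k + 2))) with hd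
  have hdlim : Tendsto d atTop (𝓝 (ρ * δ)) := by
    have h1 : Tendsto (fun k => inner ℝ ((z (k + 2) - z (k + 1)) - (z (k + 1) - z k)) (z (k + 2)))
        atTop (𝓝 0) := by
      have h2 : Tendsto (fun k => ‖(z (k + 2) - z (k + 1)) - (z (k + 1) - z k)‖ * R)
          atTop (𝓝 0) := by simpa using hda.norm.mul_const R
      refine squeeze_zero_norm (fun k => ?_) h2
      exact (norm_inner_le_norm _ _).trans
        (mul_le_mul_of_nonneg_left (hzR (k + 1)) (norm_nonneg _))
    have := ((hb2.comp (tendsto_add_atTop_nat 1)).add h1).const_mul ρ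
    simpa [hd] using this
  -- `q k` is the minimum over `C` of the Lagrangian at the price `lam (k + 1) + ρ • (z (k + 1) - z
  -- k)`. With `y (k + 1)` as competitor, `q` grows at least by the change of price paired with `π
  -- (y (k + 1))`, which is `d k` by orthogonality.
  have hqd : ∀ k, q k + d k ≤ q (k + 1) := fun k => by
    have o1 := h.opt' k (h.mem (k + 1))
    have hl : lam (k + 2) = lam (k + 1) + ρ • (π (y (k + 1)) - z (k + 2)) := h.lam_step (k + 1)
    have hb' := h.residual_mem hρ (k + 1)
    have ha' := V.sub_mem (h.z_mem (k + 2)) (h.z_mem (k + 1))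
    have ha'' := V.sub_mem (h.z_mem (k + 1)) (h.z_mem k)
    have e1 : π (y (k + 1)) = z (k + 2) + (π (y (k + 1)) - z (k + 2)) := by abel
    have key : d k = inner ℝ (lam (k + 2) + ρ • (z (k + 2) - z (k + 1))) (π (y (k + 1))) -
        inner ℝ (lam (k + 1) + ρ • (z (k + 1) - z k)) (π (y (k + 1))) := by
      rw [← inner_sub_left, hl]
      have e2 : lam (k + 1) + ρ • (π (y (k + 1)) - z (k + 2)) + ρ • (z (k + 2) - z (k + 1)) -
          (lam (k + 1) + ρ • (z (k + 1) - z k)) =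
          ρ • ((π (y (k + 1)) - z (k + 2)) + ((z (k + 2) - z (k + 1)) - (z (k + 1) - z k))) := by
        simp only [smul_add, smul_sub]
        abel
      rw [e2]
      rw [show k + 1 + 1 = k + 2 from rfl] at hb'
      have hz2 := h.z_mem (k + 2)
      simp only [hd]
      nth_rw 3 [e1]
      set b' := π (y (k + 1)) - z (k + 2)
      set c := (z (k + 2) - z (k + 1)) - (z (k + 1) - z k)
      have hc : c ∈ V := V.sub_mem ha' ha''
      have i1 : inner ℝ c b' = 0 := (Submodule.mem_orthogonal V _).1 hb' _ hc
      have i2 : inner ℝ b' (z (k + 2)) = 0 := by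
        rw [real_inner_comm]; exact (Submodule.mem_orthogonal V _).1 hb' _ hz2
      simp only [inner_add_left, inner_add_right, inner_smul_left, RCLike.conj_to_real, i1, i2,
        real_inner_self_eq_norm_sq]
      ring
    simp only [hq]
    rw [inner_sub_right] at o1
    rw [show k + 1 + 1 = k + 2 from rfl]
    linarith
  have haD : ∀ k, ‖z (k + 1) - z k‖ ≤ √(D 0) := fun k => by
    apply Real.le_sqrt_of_sq_le
    have := hanti (Nat.zero_le k)
    simp only [hD] at this ⊢
    nlinarith [sq_nonneg ‖π (y k) - z (k + 1)‖]
  -- Weak duality at the feasible point `v`: `lam` is orthogonal to `π v`, so only the bounded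
  -- increment of `z` enters the bound.
  refine not_bddAbove_of_tendsto_diff_pos (by positivity) hdlim hqd
    (R := F v + ρ * (√(D 0) * ‖π v‖)) fun k => ?_
  have o1 := h.opt' k hv
  have i1 : inner ℝ (lam (k + 1)) (π v) = 0 := by
    rw [real_inner_comm]; exact (Submodule.mem_orthogonal V _).1 (h.lam_mem _) _ hvV
  rw [inner_sub_right, inner_add_left, i1, inner_smul_left, RCLike.conj_to_real] at o1
  have i2 : inner ℝ (z (k + 1) - z k) (π v) ≤ √(D 0) * ‖π v‖ :=
    (real_inner_le_norm _ _).trans (mul_le_mul_of_nonneg_right (haD k) (norm_nonneg _))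
  have := mul_le_mul_of_nonneg_left i2 hρ.le
  simp only [hq]
  linarith

/-- Fejér monotonicity with respect to primal-dual solutions. -/
theorem antitone_dist (h : ADMMRun π V C F ρ y z lam) (hρ : 0 < ρ) {ys : E} {ls : H}
    (hs : IsSaddle π V C F ys ls) :
    Antitone fun k => ρ ^ 2 * ‖z k - π ys‖ ^ 2 + ‖lam k - ls‖ ^ 2 := by
  refine antitone_nat_of_succ_le fun k => ?_
  have o1 := h.opt' k hs.mem
  have o2 := hs.opt _ (h.mem k)
  have hb := h.residual_mem hρ k
  have hz : z (k + 1) - π ys ∈ V := V.sub_mem (h.z_mem _) hs.map_mem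
  have ha := V.sub_mem (h.z_mem (k + 1)) (h.z_mem k)
  have hl : lam (k + 1) - ls ∈ Vᗮ := Vᗮ.sub_mem (h.lam_mem _) hs.lam_mem
  have e1 : π ys - π (y k) = -((z (k + 1) - π ys) + (π (y k) - z (k + 1))) := by abel
  have e2 : π (y k) - π ys = (z (k + 1) - π ys) + (π (y k) - z (k + 1)) := by abel
  have e3 : z k - π ys = (z (k + 1) - π ys) - (z (k + 1) - z k) := by abel
  have e4 : lam k - ls = (lam (k + 1) - ls) - ρ • (π (y k) - z (k + 1)) := by
    rw [h.lam_step]; abel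
  have e5 : lam (k + 1) + ρ • (z (k + 1) - z k) =
    (lam (k + 1) - ls) + (ls + ρ • (z (k + 1) - z k)) := by abel
  rw [e1, e5] at o1
  rw [e2] at o2
  rw [e3, e4, @norm_sub_sq_real _ _ _ (z (k + 1) - π ys),
    @norm_sub_sq_real _ _ _ (lam (k + 1) - ls)]
  set p := z (k + 1) - π ys
  set a := z (k + 1) - z k
  set b := π (y k) - z (k + 1)
  set l := lam (k + 1) - ls
  have i1 : inner ℝ l p = 0 := by
    rw [real_inner_comm]; exact (Submodule.mem_orthogonal V _).1 hl _ hz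
  have i2 : inner ℝ a b = 0 := (Submodule.mem_orthogonal V _).1 hb _ ha
  simp only [inner_add_left, inner_add_right, inner_smul_left, inner_smul_right, inner_neg_right,
    RCLike.conj_to_real, i1, i2] at o1 o2 ⊢
  rw [real_inner_comm p a] at o1
  -- The sum of the two optimality conditions; these are exactly the cross terms in the expanded
  -- squares at step `k`.
  have : inner ℝ l b + ρ * inner ℝ p a ≤ 0 := by linarith
  have := mul_le_mul_of_nonneg_left this hρ.le
  nlinarith [sq_nonneg (ρ * ‖a‖), sq_nonneg ‖ρ • b‖]

/-- Any limit along which the primal iterates and the multipliers converge is a primal-dual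
solution. -/
theorem isSaddle_of_tendsto (h : ADMMRun π V C F ρ y z lam)
    (hC : IsClosed C) (hF : Continuous F) (hVc : IsClosed (V : Set H))
    (ha : Tendsto (fun k => z (k + 1) - z k) atTop (𝓝 0))
    (hb : Tendsto (fun k => π (y k) - z (k + 1)) atTop (𝓝 0))
    {ι : Type*} {l : Filter ι} [l.NeBot] {φ : ι → ℕ} (hφ : Tendsto φ l atTop) {ys : E} {ls : H}
    (hy : Tendsto (fun k => y (φ k)) l (𝓝 ys))
    (hl : Tendsto (fun k => lam (φ k + 1)) l (𝓝 ls)) :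
    IsSaddle π V C F ys ls := by
  have hπ : Tendsto (fun k => π (y (φ k))) l (𝓝 (π ys)) := (π.continuous.tendsto _).comp hy
  refine ⟨hC.mem_of_tendsto hy (.of_forall fun k => h.mem _), ?_, ?_, fun v hv => ?_⟩
  · have : Tendsto (fun k => z (φ k + 1)) l (𝓝 (π ys)) := by
      simpa using hπ.sub (hb.comp hφ)
    exact hVc.mem_of_tendsto this (.of_forall fun k => h.z_mem _)
  · exact V.isClosed_orthogonal.mem_of_tendsto hl (.of_forall fun k => h.lam_mem _)
  · have h1 : Tendsto (fun k => lam (φ k + 1) + ρ • (z (φ k + 1) - z (φ k))) l (𝓝 ls) := by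
      simpa using hl.add ((ha.comp hφ).const_smul ρ)
    have h2 := ((h1.inner (𝕜 := ℝ) (tendsto_const_nhds (x := π v) |>.sub hπ))).const_add (F v)
    exact le_of_tendsto_of_tendsto ((hF.tendsto _).comp hy) h2
      (.of_forall fun k => h.opt' (φ k) hv)

/-- Convergence of the method for bounded primal iterates if there is a primal-dual solution. -/
theorem exists_limit [FiniteDimensional ℝ H] (h : ADMMRun π V C F ρ y z lam) (hρ : 0 < ρ)
    (hC : IsClosed C) (hF : Continuous F)
    (ha : Tendsto (fun k => z (k + 1) - z k) atTop (𝓝 0))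
    (hb : Tendsto (fun k => π (y k) - z (k + 1)) atTop (𝓝 0))
    {K : Set E} (hK : IsCompact K) (hyK : ∀ k, y k ∈ K)
    {y₀ : E} {l₀ : H} (hs₀ : IsSaddle π V C F y₀ l₀) :
    ∃ ys ls, IsSaddle π V C F ys ls ∧ Tendsto (fun k => π (y k)) atTop (𝓝 (π ys)) ∧
      Tendsto lam atTop (𝓝 ls) := by
  have hVc : IsClosed (V : Set H) := V.closed_of_finiteDimensional
  have hanti := h.antitone_dist hρ hs₀
  set R := √(ρ ^ 2 * ‖z 0 - π y₀‖ ^ 2 + ‖lam 0 - l₀‖ ^ 2)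
  have hlb : ∀ k, lam k ∈ Metric.closedBall l₀ R := fun k => by
    rw [mem_closedBall_iff_norm]
    apply Real.le_sqrt_of_sq_le
    have := hanti (Nat.zero_le k)
    simp only at this
    nlinarith [sq_nonneg (ρ * ‖z k - π y₀‖)]
  obtain ⟨⟨ys, ls⟩, -, φ, hφ, hlim⟩ := (hK.prod (isCompact_closedBall l₀ R)).tendsto_subseq
    (x := fun k => (y k, lam (k + 1))) fun k => ⟨hyK k, hlb _⟩
  have hy : Tendsto (fun k => y (φ k)) atTop (𝓝 ys) := (continuous_fst.tendsto _).comp hlim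
  have hl : Tendsto (fun k => lam (φ k + 1)) atTop (𝓝 ls) := (continuous_snd.tendsto _).comp hlim
  have hs := h.isSaddle_of_tendsto hC hF hVc ha hb hφ.tendsto_atTop hy hl
  have hz : Tendsto (fun k => z (φ k + 1)) atTop (𝓝 (π ys)) := by
    simpa using ((π.continuous.tendsto _).comp hy).sub (hb.comp hφ.tendsto_atTop)
  -- The subsequential limit is itself a saddle point, so the distance to it is monotone too;
  -- tending to zero along a subsequence, it tends to zero.
  have hanti' := h.antitone_dist hρ hs
  have hsub : Tendsto (fun k => ρ ^ 2 * ‖z (φ k + 1) - π ys‖ ^ 2 + ‖lam (φ k + 1) - ls‖ ^ 2)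
      atTop (𝓝 0) := by
    have h1 := (((hz.sub_const (π ys)).norm.pow 2).const_mul (ρ ^ 2)).add
      ((hl.sub_const ls).norm.pow 2)
    simpa using h1
  have he : Tendsto (fun k => ρ ^ 2 * ‖z k - π ys‖ ^ 2 + ‖lam k - ls‖ ^ 2) atTop (𝓝 0) := by
    have h1 := tendsto_atTop_ciInf hanti' ⟨0, by rintro _ ⟨k, rfl⟩; positivity⟩
    have h2 := h1.comp ((tendsto_add_atTop_nat 1).comp hφ.tendsto_atTop)
    have := tendsto_nhds_unique h2 hsub
    rwa [this] at h1
  have hlam : Tendsto lam atTop (𝓝 ls) := by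
    rw [tendsto_iff_norm_sub_tendsto_zero]
    have h1 := squeeze_zero (fun k => sq_nonneg ‖lam k - ls‖)
      (fun k => by nlinarith [sq_nonneg (ρ * ‖z k - π ys‖)]) he
    simpa [Real.sqrt_sq] using h1.sqrt
  have hzlim : Tendsto z atTop (𝓝 (π ys)) := by
    rw [tendsto_iff_norm_sub_tendsto_zero]
    have h1 := squeeze_zero (fun k => sq_nonneg (ρ * ‖z k - π ys‖))
      (fun k => by nlinarith [sq_nonneg ‖lam k - ls‖]) he
    have h2 := h1.sqrt
    have h3 : ∀ k, √((ρ * ‖z k - π ys‖) ^ 2) = ρ * ‖z k - π ys‖ := fun k =>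
      Real.sqrt_sq (by positivity)
    simp only [h3, Real.sqrt_zero] at h2
    have h4 := h2.const_mul ρ⁻¹
    simpa [← mul_assoc, hρ.ne'] using h4
  refine ⟨ys, ls, hs, ?_, hlam⟩
  simpa using hb.add (hzlim.comp (tendsto_add_atTop_nat 1))

end ADMMRun

end ADMM

/-! ### Farkas' lemma, polyhedra and multipliers -/

section Polyhedra

/-- **Farkas' lemma** for finitely many linear functionals. -/
theorem exists_nonneg_combination_of_forall_nonpos {ι W : Type*} [AddCommGroup W] [Module ℝ W]
    (s : Finset ι) (f : ι → W →ₗ[ℝ] ℝ) (g : W →ₗ[ℝ] ℝ)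
    (h : ∀ v, (∀ i ∈ s, f i v ≤ 0) → g v ≤ 0) :
    ∃ c : ι → ℝ, (∀ i, 0 ≤ c i) ∧ g = ∑ i ∈ s, c i • f i := by
  classical
  induction s using Finset.induction_on generalizing f g with
  | empty =>
    refine ⟨0, fun _ => le_rfl, ?_⟩
    ext v
    have h1 := h v (by simp)
    have h2 := h (-v) (by simp)
    rw [map_neg] at h2
    simp only [Finset.sum_empty, LinearMap.zero_apply]
    linarith
  | insert t s ht ih =>
    -- Either `f t` is redundant and gets coefficient zero, or some `w` violates the implication
    -- without it; then one projects along `w` onto the kernel of `f t` and applies induction there.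
    by_cases hg : ∀ v, (∀ i ∈ s, f i v ≤ 0) → g v ≤ 0
    · obtain ⟨c, hc, rfl⟩ := ih f g hg
      refine ⟨Function.update c t 0, fun i => ?_, ?_⟩
      · by_cases hi : i = t
        · simp [hi]
        · simpa [hi] using hc i
      · rw [Finset.sum_insert ht]
        simp only [Function.update_self, zero_smul, zero_add]
        refine Finset.sum_congr rfl fun i hi => ?_
        rw [Function.update_of_ne (by rintro rfl; exact ht hi)]
    · push Not at hg
      obtain ⟨w₀, hw₀, hgw₀⟩ := hg
      have hft : 0 < f t w₀ := by
        by_contra hcon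
        exact hgw₀.not_ge (h w₀ (by simpa [not_lt.1 hcon] using hw₀))
      obtain ⟨w, hw, hgw, hftw⟩ : ∃ w, (∀ i ∈ s, f i w ≤ 0) ∧ 0 < g w ∧ f t w = 1 := by
        refine ⟨(f t w₀)⁻¹ • w₀, fun i hi => ?_, ?_, ?_⟩
        · rw [map_smul, smul_eq_mul]
          exact mul_nonpos_of_nonneg_of_nonpos (inv_nonneg.2 hft.le) (hw₀ i hi)
        · rw [map_smul, smul_eq_mul]
          positivity
        · rw [map_smul, smul_eq_mul, inv_mul_cancel₀ hft.ne']
      obtain ⟨c, hc, hcg⟩ := ih (fun i => f i - f i w • f t) (g - g w • f t) fun v hv => by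
        have := h (v - f t v • w) fun i hi => by
          rcases Finset.mem_insert.1 hi with rfl | hi
          · simp [hftw]
          · have := hv i hi
            simp only [LinearMap.sub_apply, LinearMap.smul_apply, smul_eq_mul] at this
            rw [map_sub, map_smul, smul_eq_mul]
            linarith
        rw [map_sub, map_smul, smul_eq_mul] at this
        simp only [LinearMap.sub_apply, LinearMap.smul_apply, smul_eq_mul]
        linarith
      have hneg : ∑ i ∈ s, c i * f i w ≤ 0 := Finset.sum_nonpos fun i hi =>
        mul_nonpos_of_nonneg_of_nonpos (hc i) (hw i hi)
      refine ⟨Function.update c t (g w - ∑ i ∈ s, c i * f i w), fun i => ?_, ?_⟩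
      · by_cases hi : i = t
        · subst hi
          simp only [Function.update_self]
          linarith
        · simpa [hi] using hc i
      · rw [Finset.sum_insert ht, Function.update_self]
        have h1 : ∑ i ∈ s, Function.update c t (g w - ∑ i ∈ s, c i * f i w) i • f i =
            ∑ i ∈ s, c i • f i := Finset.sum_congr rfl fun i hi => by
          rw [Function.update_of_ne (by rintro rfl; exact ht hi)]
        rw [h1]
        ext v
        have h2 := LinearMap.congr_fun hcg v
        simp only [LinearMap.sub_apply, LinearMap.smul_apply, smul_eq_mul, LinearMap.add_apply,
          LinearMap.sum_apply, mul_sub, Finset.sum_sub_distrib] at h2 ⊢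
        rw [sub_mul, Finset.sum_mul]
        simp only [mul_assoc]
        linarith

/-- A polyhedron: an intersection of finitely many closed half-spaces. -/
def IsPolyhedron {W : Type*} [AddCommGroup W] [Module ℝ W] (C : Set W) : Prop :=
  ∃ (ι : Type) (_ : Finite ι) (a : ι → W →ₗ[ℝ] ℝ) (b : ι → ℝ), C = {v | ∀ t, a t v ≤ b t}

theorem IsPolytope.isPolyhedron {d : ℕ} {P : Set (EuclideanSpace ℝ (Fin d))}
    (h : IsPolytope P) : IsPolyhedron P := by
  obtain ⟨-, r, a, b, rfl⟩ := h
  exact ⟨Fin r, inferInstance, fun t => (innerSL ℝ (a t)).toLinearMap, b, rfl⟩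

namespace IsPolyhedron

variable {W W' : Type*} [AddCommGroup W] [Module ℝ W] [AddCommGroup W'] [Module ℝ W']

theorem iInter {κ : Type} [Finite κ] {C : κ → Set W} (h : ∀ k, IsPolyhedron (C k)) :
    IsPolyhedron (⋂ k, C k) := by
  choose ι hι a b hC using h
  refine ⟨Σ k, ι k, inferInstance, fun p => a p.1 p.2, fun p => b p.1 p.2, ?_⟩
  ext v
  simp [hC, Sigma.forall]

theorem inter {C D : Set W} (hC : IsPolyhedron C) (hD : IsPolyhedron D) :
    IsPolyhedron (C ∩ D) := by
  rw [Set.inter_eq_iInter]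
  exact iInter fun k => by cases k <;> assumption

theorem preimage {C : Set W} (hC : IsPolyhedron C) (f : W' →ᵃ[ℝ] W) :
    IsPolyhedron (f ⁻¹' C) := by
  obtain ⟨ι, hι, a, b, rfl⟩ := hC
  refine ⟨ι, hι, fun t => (a t).comp f.linear, fun t => b t - a t (f 0), ?_⟩
  ext v
  have hf : f v = f.linear v + f 0 := by
    have := f.map_vadd 0 v
    simpa using this
  simp [hf, le_sub_iff_add_le]

theorem setOf_apply_nonpos {q : ℕ} (f : W →ᵃ[ℝ] (Fin q → ℝ)) : IsPolyhedron {v | f v ≤ 0} :=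
  preimage (C := {v : Fin q → ℝ | v ≤ 0})
    ⟨Fin q, inferInstance, fun t => LinearMap.proj t, 0, by ext v; simp [Pi.le_def]⟩ f

theorem singleton_zero [FiniteDimensional ℝ W] : IsPolyhedron ({0} : Set W) := by
  let B := Module.finBasis ℝ W
  refine ⟨Fin (Module.finrank ℝ W) ⊕ Fin (Module.finrank ℝ W), inferInstance,
    Sum.elim (fun t => B.coord t) (fun t => -B.coord t), 0, ?_⟩
  ext v
  simp only [Set.mem_singleton_iff, Sum.forall, Sum.elim_inl, Sum.elim_inr, LinearMap.neg_apply,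
    Pi.zero_apply, Left.neg_nonpos_iff, Set.mem_ofPred_eq]
  constructor
  · rintro rfl
    simp
  · rintro ⟨h1, h2⟩
    exact B.forall_coord_eq_zero_iff.1 fun t => le_antisymm (h1 t) (h2 t)

theorem setOf_eq_zero [FiniteDimensional ℝ W] (f : W' →ᵃ[ℝ] W) : IsPolyhedron {v | f v = 0} :=
  singleton_zero.preimage f

theorem convex {C : Set W} (hC : IsPolyhedron C) : Convex ℝ C := by
  obtain ⟨ι, hι, a, b, rfl⟩ := hC
  rw [Set.ofPred_forall]
  exact convex_iInter fun t => convex_halfSpace_le (a t).isLinear (b t)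

end IsPolyhedron

theorem IsPolyhedron.isClosed {W : Type*} [NormedAddCommGroup W] [NormedSpace ℝ W]
    [FiniteDimensional ℝ W] {C : Set W} (hC : IsPolyhedron C) : IsClosed C := by
  obtain ⟨ι, hι, a, b, rfl⟩ := hC
  rw [Set.ofPred_forall]
  exact isClosed_iInter fun t =>
    isClosed_le (LinearMap.continuous_of_finiteDimensional (a t)) continuous_const

/-- First-order optimality condition for a minimizer of a continuous convex function over a convex
set. -/
theorem ConvexOn.exists_subgradient_of_isMinOn {E : Type*} [NormedAddCommGroup E]
    [NormedSpace ℝ E] {F : E → ℝ} (hF : ConvexOn ℝ Set.univ F) (hFc : Continuous F) {Q : Set E}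
    (hQ : Convex ℝ Q) {y : E} (hy : y ∈ Q) (hmin : IsMinOn F Q y) :
    ∃ p : E →L[ℝ] ℝ, (∀ v, F y + p (v - y) ≤ F v) ∧ ∀ v ∈ Q, 0 ≤ p (v - y) := by
  have hs₁ : Convex ℝ {p : E × ℝ | p.1 ∈ Set.univ ∧ F p.1 < p.2} := hF.convex_strict_epigraph
  have hs₂ : IsOpen {p : E × ℝ | p.1 ∈ Set.univ ∧ F p.1 < p.2} := by
    simpa using isOpen_lt (hFc.comp continuous_fst) continuous_snd
  have ht : Convex ℝ (Q ×ˢ Set.Iic (F y)) := hQ.prod (convex_Iic _)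
  -- Minimality of `y` separates the open strict epigraph from `Q ×ˢ Set.Iic (F y)`; the slope of
  -- the separating hyperplane is the subgradient.
  have hdisj : Disjoint {p : E × ℝ | p.1 ∈ Set.univ ∧ F p.1 < p.2} (Q ×ˢ Set.Iic (F y)) := by
    rw [Set.disjoint_left]
    rintro ⟨v, t⟩ ⟨-, h1⟩ ⟨h2, h3⟩
    exact absurd (hmin h2) (not_le.2 (lt_of_lt_of_le h1 h3))
  obtain ⟨f, u, hf1, hf2⟩ := geometric_hahn_banach_open hs₁ hs₂ ht hdisj
  set g : E →L[ℝ] ℝ := f.comp (ContinuousLinearMap.inl ℝ E ℝ)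
  set α := f (0, 1)
  have hfd : ∀ v t, f (v, t) = g v + t * α := fun v t => by
    have : (v, t) = (v, (0 : ℝ)) + t • ((0 : E), (1 : ℝ)) := by simp
    rw [this, map_add, map_smul]
    rfl
  have hu : u ≤ g y + F y * α := hfd y (F y) ▸ hf2 (y, F y) ⟨hy, Set.self_mem_Iic⟩
  -- The hyperplane is not vertical: `(y, F y + 1)` lies strictly on the epigraph side.
  have hα : α < 0 := by
    have := hf1 (y, F y + 1) ⟨trivial, by simp⟩
    rw [hfd] at this
    linarith
  have hle : ∀ v, g v + F v * α ≤ u := fun v => by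
    refine le_of_forall_pos_lt_add fun ε hε => ?_
    have := hf1 (v, F v + ε / (-α)) ⟨trivial, by
      have : 0 < ε / (-α) := div_pos hε (by linarith)
      simpa using this⟩
    rw [hfd, add_mul, div_mul_eq_mul_div, mul_div_assoc, div_neg, div_self hα.ne] at this
    linarith
  refine ⟨(-α)⁻¹ • g, fun v => ?_, fun v hv => ?_⟩
  · have h1 := hle v
    have h3 : (-α)⁻¹ * (g v - g y) ≤ F v - F y := by
      rw [inv_mul_le_iff₀ (by linarith)]
      linarith
    simp only [smul_apply, map_sub, smul_eq_mul]
    linarith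
  · have h1 : u ≤ g v + F y * α := hfd v (F y) ▸ hf2 (v, F y) ⟨hv, Set.self_mem_Iic⟩
    have h2 := hle y
    rw [smul_apply, map_sub, smul_eq_mul]
    exact mul_nonneg (inv_nonneg.2 (by linarith)) (by linarith)

/-- First-order optimality condition for the minimization of a convex function with a linear and
a proximal term. -/
theorem ConvexOn.le_add_inner_of_isMinOn {H E : Type*} [NormedAddCommGroup H]
    [InnerProductSpace ℝ H] [NormedAddCommGroup E] [NormedSpace ℝ E] {π : E →L[ℝ] H} {C : Set E}
    {F : E → ℝ} {ρ : ℝ} {l z : H} {y : E} (hF : ConvexOn ℝ Set.univ F) (hC : Convex ℝ C)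
    (hy : y ∈ C)
    (hmin : IsMinOn (fun v => F v + inner ℝ l (π v) + ρ / 2 * ‖π v - z‖ ^ 2) C y)
    {v : E} (hv : v ∈ C) : F y ≤ F v + inner ℝ (l + ρ • (π y - z)) (π v - π y) := by
  set d := π v - π y
  -- Comparison with `(1 - t) • y + t • v`, divided by `t`; the proximal term leaves an error of
  -- order `t`.
  have key : ∀ t : ℝ, t ∈ Set.Ioc 0 1 →
      0 ≤ (F v + inner ℝ (l + ρ • (π y - z)) d - F y) + t * (ρ / 2 * ‖d‖ ^ 2) := by
    intro t ht
    have hw : (1 - t) • y + t • v ∈ C := hC hy hv (by linarith [ht.2]) ht.1.le (by ring)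
    have h1 := hF.2 (Set.mem_univ y) (Set.mem_univ v) (by linarith [ht.2] : 0 ≤ 1 - t) ht.1.le
      (by ring)
    have h2 := hmin hw
    have e1 : π ((1 - t) • y + t • v) = π y + t • d := by
      rw [map_add, map_smul, map_smul]
      module
    have e2 : π y + t • d - z = (π y - z) + t • d := by abel
    simp only [Set.mem_ofPred_eq, e1] at h2
    rw [e2, @norm_add_sq_real _ _ _ (π y - z), norm_smul, mul_pow, Real.norm_eq_abs, sq_abs,
      inner_add_right, inner_smul_right, inner_smul_right] at h2
    simp only [smul_eq_mul] at h1
    rw [inner_add_left, inner_smul_left, RCLike.conj_to_real]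
    refine nonneg_of_mul_nonneg_right ?_ ht.1
    nlinarith
  have hlim : Tendsto (fun t : ℝ => (F v + inner ℝ (l + ρ • (π y - z)) d - F y) +
      t * (ρ / 2 * ‖d‖ ^ 2)) (𝓝[>] 0)
      (𝓝 (F v + inner ℝ (l + ρ • (π y - z)) d - F y)) := by
    have : Continuous fun t : ℝ => (F v + inner ℝ (l + ρ • (π y - z)) d - F y) +
      t * (ρ / 2 * ‖d‖ ^ 2) := by fun_prop
    have := this.tendsto 0
    rw [zero_mul, add_zero] at this
    exact this.mono_left nhdsWithin_le_nhds
  have := ge_of_tendsto hlim (by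
    filter_upwards [Ioc_mem_nhdsGT (zero_lt_one (α := ℝ))] with t ht using key t ht)
  linarith

/-- A minimizer of a convex function over the points of a polyhedron that satisfy a consensus
constraint has a multiplier. -/
theorem IsPolyhedron.exists_isSaddle {H E : Type*} [NormedAddCommGroup H] [InnerProductSpace ℝ H]
    [FiniteDimensional ℝ H] [NormedAddCommGroup E] [NormedSpace ℝ E] {π : E →L[ℝ] H}
    {V : Submodule ℝ H} {C : Set E} {F : E → ℝ} (hC : IsPolyhedron C)
    (hF : ConvexOn ℝ Set.univ F) (hFc : Continuous F) {y : E} (hy : y ∈ C) (hyV : π y ∈ V)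
    (hmin : IsMinOn F (C ∩ π ⁻¹' V) y) : ∃ l, IsSaddle π V C F y l := by
  classical
  obtain ⟨p, hp1, hp2⟩ := hF.exists_subgradient_of_isMinOn hFc
    (hC.convex.inter (V.convex.linear_preimage π.toLinearMap))
    (show y ∈ C ∩ π ⁻¹' V from ⟨hy, hyV⟩) hmin
  obtain ⟨ι, hι, a, b, rfl⟩ := hC
  have := Fintype.ofFinite ι
  let B := Module.finBasis ℝ Vᗮ
  let r : Fin (Module.finrank ℝ Vᗮ) → E →ₗ[ℝ] ℝ := fun t =>
    ((innerSL ℝ (B t : H)).comp π).toLinearMap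
  -- Active inequalities, and the equations `π v ∈ V` as pairs of opposite inequalities over a basis
  -- of `Vᗮ`.
  let f : ι ⊕ (Fin (Module.finrank ℝ Vᗮ) ⊕ Fin (Module.finrank ℝ Vᗮ)) → E →ₗ[ℝ] ℝ :=
    Sum.elim a (Sum.elim r (fun t => -r t))
  let s : Finset (ι ⊕ (Fin (Module.finrank ℝ Vᗮ) ⊕ Fin (Module.finrank ℝ Vᗮ))) :=
    (Finset.univ.filter fun t => a t y = b t).disjSum Finset.univ
  obtain ⟨c, hc, hcp⟩ := exists_nonneg_combination_of_forall_nonpos s f (-p.toLinearMap)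
      fun v hv => by
    have ha : ∀ t, a t y = b t → a t v ≤ 0 := fun t ht => hv (.inl t) (by simp [s, ht])
    have hr : ∀ t, inner ℝ (B t : H) (π v) = 0 := fun t => by
      refine le_antisymm (hv (.inr (.inl t)) (by simp [s])) ?_
      have := hv (.inr (.inr t)) (by simp [s])
      simpa [f, r] using this
    have hvV : π v ∈ V := by
      rw [← V.orthogonal_orthogonal, Submodule.mem_orthogonal]
      intro u hu
      have h1 : (⟨u, hu⟩ : Vᗮ) = ∑ t, B.repr ⟨u, hu⟩ t • B t := (B.sum_repr _).symm
      have h2 : u = ∑ t, B.repr ⟨u, hu⟩ t • (B t : H) := by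
        have h3 := congrArg (Vᗮ.subtype) h1
        rwa [map_sum] at h3
      rw [h2, sum_inner]
      exact Finset.sum_eq_zero fun t _ => by rw [inner_smul_left, hr, mul_zero]
    -- A small step along `v` stays in the polyhedron: active constraints do not increase and the
    -- finitely many inactive ones have slack.
    have hev : ∀ᶠ ε : ℝ in 𝓝[>] 0, ∀ t, a t (y + ε • v) ≤ b t := by
      rw [eventually_all]
      intro t
      by_cases ht : a t y = b t
      · filter_upwards [self_mem_nhdsWithin] with ε hε
        rw [map_add, map_smul, smul_eq_mul, ht]
        nlinarith [ha t ht, Set.mem_Ioi.1 hε]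
      · have hlt : a t y < b t := lt_of_le_of_ne (hy t) ht
        have hcont : Tendsto (fun ε : ℝ => a t y + ε * a t v) (𝓝 0) (𝓝 (a t y)) := by
          have : Continuous fun ε : ℝ => a t y + ε * a t v := by fun_prop
          simpa using this.tendsto 0
        filter_upwards [(hcont.mono_left nhdsWithin_le_nhds).eventually (gt_mem_nhds hlt)]
          with ε hε
        rw [map_add, map_smul, smul_eq_mul]
        exact hε.le
    obtain ⟨ε, hε, hε0⟩ := (hev.and self_mem_nhdsWithin).exists
    have hQ : y + ε • v ∈ {v | ∀ t, a t v ≤ b t} ∩ π ⁻¹' V := ⟨hε, by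
      rw [Set.mem_preimage, map_add, map_smul]
      exact V.add_mem hyV (V.smul_mem _ hvV)⟩
    have := hp2 _ hQ
    rw [add_sub_cancel_left, map_smul, smul_eq_mul] at this
    have := nonneg_of_mul_nonneg_right this (Set.mem_Ioi.1 hε0)
    simpa using this
  -- The coefficients of each opposite pair combine into the multiplier; the active inequalities
  -- contribute a nonpositive amount on `C` and can be dropped.
  refine ⟨∑ t, (c (.inr (.inl t)) - c (.inr (.inr t))) • (B t : H), hy, hyV,
    Vᗮ.sum_mem fun t _ => Vᗮ.smul_mem _ (B t).2, fun v hv => ?_⟩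
  have h1 := hp1 v
  have h2 := LinearMap.congr_fun hcp (v - y)
  simp only [s, f, Finset.sum_disjSum, Fintype.sum_sum_type, LinearMap.add_apply,
    LinearMap.sum_apply, LinearMap.smul_apply, LinearMap.neg_apply, Sum.elim_inl, Sum.elim_inr,
    smul_eq_mul, ContinuousLinearMap.coe_coe] at h2
  have h3 : ∑ t with a t y = b t, c (.inl t) * a t (v - y) ≤ 0 := Finset.sum_nonpos fun t ht => by
    refine mul_nonpos_of_nonneg_of_nonpos (hc _) ?_
    rw [map_sub, (Finset.mem_filter.1 ht).2]
    linarith [hv t]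
  have h4 : inner ℝ (∑ t, (c (.inr (.inl t)) - c (.inr (.inr t))) • (B t : H)) (π v - π y) =
      ∑ t, c (.inr (.inl t)) * r t (v - y) + ∑ t, c (.inr (.inr t)) * -r t (v - y) := by
    rw [sum_inner, ← Finset.sum_add_distrib]
    refine Finset.sum_congr rfl fun t _ => ?_
    rw [inner_smul_left, RCLike.conj_to_real, ← map_sub]
    simp only [r, ContinuousLinearMap.coe_coe, ContinuousLinearMap.comp_apply, innerSL_apply_apply]
    ring
  rw [h4]
  linarith

end Polyhedra

/-! ### Euclidean structure, consensus space and costs of the network -/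

namespace PWANetwork

variable {M : ℕ} (S : PWANetwork M) (N : ℕ)

/-- the Euclidean space of families of augmented trajectories -/
abbrev AugSpace : Type :=
  PiLp 2 fun i : Fin M => WithLp 2 (PiLp 2 (fun _ : Fin (N + 1) => S.St i) ×
    PiLp 2 fun j : S.Nb i => PiLp 2 fun _ : Fin (N + 1) => S.St j)

/-- identification of families of augmented trajectories with vectors of a Euclidean space -/
def augEquiv : (∀ i, S.Aug N i) ≃ₗ[ℝ] S.AugSpace N where
  toFun a := WithLp.toLp 2 fun i => WithLp.toLp 2
    (WithLp.toLp 2 (a i).1, WithLp.toLp 2 fun j => WithLp.toLp 2 ((a i).2 j))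
  invFun b i := ((b i).fst.ofLp, fun j => ((b i).snd j).ofLp)
  map_add' _ _ := rfl
  map_smul' _ _ := rfl
  left_inv _ := rfl
  right_inv _ := rfl

/-- Plain products carry the sup norm; the detour through `AugSpace` supplies the inner product that
the method uses. -/
theorem inner_augEquiv (a b : ∀ i, S.Aug N i) :
    inner ℝ (S.augEquiv N a) (S.augEquiv N b) = ∑ i, S.dot i (a i) (b i) := by
  simp only [PiLp.inner_apply, WithLp.prod_inner_apply]
  rfl

theorem norm_augEquiv_sq (a : ∀ i, S.Aug N i) :
    ‖S.augEquiv N a‖ ^ 2 = ∑ i, S.dot i (a i) (a i) := by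
  rw [← real_inner_self_eq_norm_sq, inner_augEquiv]

/-- the augmented trajectories of a global decision variable -/
def augOf : S.Glob N →L[ℝ] S.AugSpace N :=
  LinearMap.toContinuousLinearMap ((S.augEquiv N).toLinearMap.comp
    (LinearMap.pi fun i => (LinearMap.fst ℝ (S.Aug N i) (S.Inputs N i)).comp (LinearMap.proj i)))

theorem augOf_apply (y : S.Glob N) : S.augOf N y = S.augEquiv N fun i => (y i).1 := rfl

/-- the consistent augmented trajectories that belong to given trajectories -/
def consistentAug : (∀ i, S.Traj N i) →ₗ[ℝ] S.AugSpace N :=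
  (S.augEquiv N).toLinearMap.comp
    (LinearMap.pi fun i =>
      (LinearMap.proj i).prod (LinearMap.pi fun j => LinearMap.proj (j : Fin M)))

theorem consistentAug_apply (z : ∀ i, S.Traj N i) :
    S.consistentAug N z = S.augEquiv N (S.ztilde z) := rfl

/-- the space of consistent augmented trajectories -/
def consensus : Submodule ℝ (S.AugSpace N) := LinearMap.range (S.consistentAug N)

theorem augOf_mem_consensus {y : S.Glob N} : S.augOf N y ∈ S.consensus N ↔ S.Consistent y := by
  constructor
  · rintro ⟨z, hz⟩ i j k
    have h1 : S.ztilde z = fun i => (y i).1 := (S.augEquiv N).injective hz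
    have h2 : ∀ i, (y i).1 = (z i, fun j : S.Nb i => z j) := fun i => (congrFun h1 i).symm
    rw [h2 i, h2 j]
  · intro h
    refine ⟨fun i => (y i).1.1, ?_⟩
    rw [consistentAug_apply, augOf_apply]
    congr 1
    funext i
    refine Prod.ext rfl ?_
    funext j k
    exact (h i j k).symm

theorem continuous_residual : Continuous (S.residual (N := N)) := by
  unfold residual
  fun_prop

theorem residual_eq_zero {y : S.Glob N} : S.residual y = 0 ↔ S.Consistent y := by
  have h0 : ∀ i, ∀ j : S.Nb i, 0 ≤ ∑ k, ‖(y i).1.2 j k - (y j).1.1 k‖ ^ 2 := fun i j =>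
    Finset.sum_nonneg fun k _ => sq_nonneg _
  rw [residual, Finset.sum_eq_zero_iff_of_nonneg fun i _ =>
    Finset.sum_nonneg fun j _ => Real.sqrt_nonneg _]
  simp only [Finset.sum_eq_zero_iff_of_nonneg fun _ _ => Real.sqrt_nonneg _, Finset.mem_univ,
    true_imp_iff, Real.sqrt_eq_zero (h0 _ _),
    Finset.sum_eq_zero_iff_of_nonneg fun _ _ => sq_nonneg _]
  simp [Consistent, sub_eq_zero]

/-- Subtracting a consistent family changes no difference between copy and original, so the residual
is a continuous function of `augOf y - z` that vanishes at zero. -/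
theorem tendsto_residual_zero {α : Type*} {l : Filter α} {y : α → S.Glob N} {z : α → S.AugSpace N}
    (hz : ∀ a, z a ∈ S.consensus N) (h : Tendsto (fun a => S.augOf N (y a) - z a) l (𝓝 0)) :
    Tendsto (fun a => S.residual (y a)) l (𝓝 0) := by
  have hc : Continuous fun b : S.AugSpace N => S.residual
      (fun i => (((S.augEquiv N).symm b i, 0) : S.Loc N i)) := by
    refine (S.continuous_residual N).comp (continuous_pi fun i => ?_)
    refine Continuous.prodMk ?_ continuous_const
    exact (continuous_apply i).comp
      (LinearMap.continuous_of_finiteDimensional (S.augEquiv N).symm.toLinearMap)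
  have h1 := (hc.tendsto 0).comp h
  have h2 : S.residual (fun i => (((S.augEquiv N).symm 0 i, 0) : S.Loc N i)) = 0 := by
    rw [residual_eq_zero, map_zero]
    intro i j k
    rfl
  rw [h2] at h1
  refine h1.congr fun a => ?_
  obtain ⟨w, hw⟩ := hz a
  have h3 : (S.augEquiv N).symm (S.augOf N (y a) - z a) = fun i => (y a i).1 - S.ztilde w i := by
    rw [← hw, augOf_apply, consistentAug_apply, ← map_sub, LinearEquiv.symm_apply_apply]
    rfl
  simp only [Function.comp, h3, residual]
  refine Finset.sum_congr rfl fun i _ => Finset.sum_congr rfl fun j _ => ?_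
  congr 1
  refine Finset.sum_congr rfl fun k _ => ?_
  congr 2
  change ((y a i).1.2 j k - w j k) - ((y a j).1.1 k - w j k) = _
  abel

/-- the total cost -/
def totalCost (y : S.Glob N) : ℝ := ∑ i, S.cost i (y i)

theorem cost_convexOn (i : Fin M) : ConvexOn ℝ Set.univ (S.cost (N := N) i) := by
  unfold cost
  refine ConvexOn.add ?_ ?_
  · have h : ∀ k : Fin N, ConvexOn ℝ Set.univ fun y : S.Loc N i =>
        S.stage i (y.1.1 k.castSucc, y.2 k, fun j => y.1.2 j k.castSucc) := fun k =>
      (S.stage_convex i).comp_linearMap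
        { toFun := fun y : S.Loc N i => (y.1.1 k.castSucc, y.2 k,
            (fun j => y.1.2 j k.castSucc : ∀ j : S.Nb i, S.St j))
          map_add' := fun _ _ => rfl
          map_smul' := fun _ _ => rfl }
    refine ⟨convex_univ, fun a _ b _ s t hs ht hst => ?_⟩
    simp only [Finset.smul_sum, ← Finset.sum_add_distrib]
    exact Finset.sum_le_sum fun k _ => (h k).2 trivial trivial hs ht hst
  · exact (S.Vf_convex i).comp_linearMap
      { toFun := fun y : S.Loc N i => y.1.1 (Fin.last N)
        map_add' := fun _ _ => rfl
        map_smul' := fun _ _ => rfl }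

theorem totalCost_convexOn : ConvexOn ℝ Set.univ (S.totalCost N) := by
  refine ⟨convex_univ, fun a _ b _ s t hs ht hst => ?_⟩
  simp only [totalCost, Finset.smul_sum, ← Finset.sum_add_distrib]
  exact Finset.sum_le_sum fun i _ => (S.cost_convexOn N i).2 trivial trivial hs ht hst

theorem continuous_totalCost : Continuous (S.totalCost N) := by
  rw [← continuousOn_univ]
  exact (S.totalCost_convexOn N).continuousOn isOpen_univ

/-- The local objectives have separate variables, so simultaneous local minimizers minimize this
global augmented Lagrangian. -/
theorem sum_augLagrangian (ρ : ℝ) (z lam : ∀ i, S.Aug N i) (y : S.Glob N) :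
    ∑ i, S.augLagrangian ρ i (z i) (lam i) (y i) =
      S.totalCost N y + inner ℝ (S.augEquiv N lam) (S.augOf N y) +
        ρ / 2 * ‖S.augOf N y - S.augEquiv N z‖ ^ 2 := by
  rw [augOf_apply, ← map_sub, norm_augEquiv_sq, inner_augEquiv, Finset.mul_sum, totalCost,
    ← Finset.sum_add_distrib, ← Finset.sum_add_distrib]
  rfl

/-- The consistent trajectories formed from the averages are the orthogonal projection. -/
theorem augOf_sub_average_mem (y : S.Glob N) :
    S.augOf N y - S.consistentAug N (S.average y) ∈ (S.consensus N)ᗮ := by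
  rw [Submodule.mem_orthogonal]
  rintro _ ⟨v, rfl⟩
  set z := S.average y with hz
  rw [augOf_apply, consistentAug_apply, consistentAug_apply, ← map_sub, inner_augEquiv]
  have h1 : ∀ i, S.dot i (S.ztilde v i) (((fun i => (y i).1) - S.ztilde z) i) =
      ∑ k, inner ℝ (v i k) ((y i).1.1 k - z i k) +
        ∑ j : Fin M, if hj : j ∈ S.Nb i then
          ∑ k, inner ℝ (v j k) ((y i).1.2 ⟨j, hj⟩ k - z j k) else 0 := fun i => by
    rw [Finset.sum_dite, Finset.sum_const_zero, add_zero, dot]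
    congr 1
    refine Finset.sum_bij' (fun j _ => ⟨j.1, by simp⟩)
      (fun j _ => ⟨j.1, by simpa using j.2⟩) ?_ ?_ ?_ ?_ ?_ <;> intros <;> first | rfl | simp
  simp only [h1]
  rw [Finset.sum_add_distrib]
  -- Copies are regrouped by the subsystem they describe instead of the one that holds them; each
  -- group then cancels against its average.
  rw [Finset.sum_comm (f := fun i j => if hj : j ∈ S.Nb i then
    ∑ k, inner ℝ (v j k) ((y i).1.2 ⟨j, hj⟩ k - z j k) else 0), ← Finset.sum_add_distrib]
  refine Finset.sum_eq_zero fun i _ => ?_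
  rw [Finset.sum_dite, Finset.sum_const_zero, add_zero, Finset.sum_comm, ← Finset.sum_add_distrib]
  refine Finset.sum_eq_zero fun k _ => ?_
  rw [← inner_sum, ← inner_add_right, Finset.sum_sub_distrib, Finset.sum_const, Finset.card_univ,
    Fintype.card_coe]
  have h2 : (((Finset.univ.filter fun j => i ∈ S.Nb j).card : ℝ) + 1) • z i =
      (y i).1.1 + ∑ j : (Finset.univ.filter fun j => i ∈ S.Nb j),
        (y j).1.2 ⟨i, (Finset.mem_filter.mp j.2).2⟩ := by
    rw [hz]
    exact smul_inv_smul₀ (by positivity) _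
  have h3 : (((Finset.univ.filter fun j => i ∈ S.Nb j).card : ℝ) + 1) • z i k =
      (y i).1.1 k + ∑ j : (Finset.univ.filter fun j => i ∈ S.Nb j),
        (y j).1.2 ⟨i, (Finset.mem_filter.mp j.2).2⟩ k := by
    have h4 := Finset.sum_apply (M := fun _ => S.St i) k Finset.univ
      fun j : (Finset.univ.filter fun j => i ∈ S.Nb j) =>
        ((y j).1.2 ⟨i, (Finset.mem_filter.mp j.2).2⟩ : Fin (N + 1) → S.St i)
    exact (congrFun h2 k).trans (congrArg ((y i).1.1 k + ·) h4)
  rw [add_smul, one_smul, Nat.cast_smul_eq_nsmul] at h3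
  convert inner_zero_right _ using 2
  rw [sub_add_sub_comm, ← h3]
  abel

/-! ### Local feasible sets: polyhedral structure and bounds -/

/-- the global decision variables that satisfy the local constraints for given switching
sequences -/
def localFeasible (s : ∀ i, S.SwSeq N i) (x : ∀ i, S.St i) : Set (S.Glob N) :=
  {y | ∀ i, y i ∈ S.Yloc N i (x i) ∩ S.Yseq i (s i)}

/-- the state of subsystem `i` at time `k` -/
def stateAt (i : Fin M) (k : Fin (N + 1)) : S.Glob N →ₗ[ℝ] S.St i :=
  LinearMap.proj k ∘ₗ LinearMap.fst ℝ (S.Traj N i) (S.Copies N i) ∘ₗ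
    LinearMap.fst ℝ (S.Aug N i) (S.Inputs N i) ∘ₗ LinearMap.proj i

/-- the input of subsystem `i` at time `k` -/
def inputAt (i : Fin M) (k : Fin N) : S.Glob N →ₗ[ℝ] S.In i :=
  LinearMap.proj k ∘ₗ LinearMap.snd ℝ (S.Aug N i) (S.Inputs N i) ∘ₗ LinearMap.proj i

/-- the copies of the neighbor states held by subsystem `i` at time `k` -/
def copiesAt (i : Fin M) (k : Fin (N + 1)) : S.Glob N →ₗ[ℝ] ∀ j : S.Nb i, S.St j :=
  LinearMap.pi fun j => LinearMap.proj k ∘ₗ LinearMap.proj j ∘ₗ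
    LinearMap.snd ℝ (S.Traj N i) (S.Copies N i) ∘ₗ
    LinearMap.fst ℝ (S.Aug N i) (S.Inputs N i) ∘ₗ LinearMap.proj i

/-- the defect of the affine dynamics of region `l` at time `k` -/
def dynDefect (i : Fin M) (l : Fin (S.L i)) (k : Fin N) : S.Glob N →ᵃ[ℝ] S.St i :=
  (S.stateAt N i k.succ - S.A i l ∘ₗ S.stateAt N i k.castSucc - S.B i l ∘ₗ S.inputAt N i k -
    ∑ j, S.Acpl i l j ∘ₗ LinearMap.proj j ∘ₗ S.copiesAt N i k.castSucc).toAffineMap -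
    AffineMap.const ℝ _ (S.c i l)

theorem dynDefect_eq_zero {i : Fin M} {l : Fin (S.L i)} {k : Fin N} {y : S.Glob N} :
    S.dynDefect N i l k y = 0 ↔ (y i).1.1 k.succ =
      S.aff i l ((y i).1.1 k.castSucc) ((y i).2 k) (fun j => (y i).1.2 j k.castSucc) := by
  have h : S.dynDefect N i l k y = (y i).1.1 k.succ -
      S.aff i l ((y i).1.1 k.castSucc) ((y i).2 k) (fun j => (y i).1.2 j k.castSucc) := by
    simp only [dynDefect, AffineMap.coe_sub, Pi.sub_apply, LinearMap.coe_toAffineMap,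
      LinearMap.sub_apply, LinearMap.sum_apply, LinearMap.comp_apply, AffineMap.coe_const,
      Function.const_apply, aff]
    change (y i).1.1 k.succ - S.A i l ((y i).1.1 k.castSucc) - S.B i l ((y i).2 k) -
      ∑ j, S.Acpl i l j ((y i).1.2 j k.castSucc) - S.c i l = _
    abel
  rw [h, sub_eq_zero]

/-- the local constraints other than the input constraints -/
def stateFeasible (s : ∀ i, S.SwSeq N i) (x : ∀ i, S.St i) : Set (S.Glob N) :=
  ⋂ i, (((⋂ k, {y | (S.h i).comp
      ((S.stateAt N i k).prod (S.copiesAt N i k)).toAffineMap y ≤ 0}) ∩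
    (⋂ k, (S.stateAt N i k).toAffineMap ⁻¹' S.P i (s i k))) ∩
    ((⋂ k : Fin N, {y | S.dynDefect N i (s i k.castSucc) k y = 0}) ∩
    {y | ((S.stateAt N i 0).toAffineMap - AffineMap.const ℝ (S.Glob N) (x i) :
        S.Glob N →ᵃ[ℝ] S.St i) y = 0}))

theorem isPolyhedron_stateFeasible (s : ∀ i, S.SwSeq N i) (x : ∀ i, S.St i) :
    IsPolyhedron (S.stateFeasible N s x) :=
  .iInter fun i => .inter
    (.inter (.iInter fun _ => .setOf_apply_nonpos _)
      (.iInter fun k => (S.P_polytope i (s i k)).isPolyhedron.preimage _))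
    (.inter (.iInter fun _ => .setOf_eq_zero _) (.setOf_eq_zero _))

/-- The input constraints are split off because they alone need not be polyhedral. The constraint
`x_i(k) ∈ X_i` follows from membership in the selected region. -/
theorem localFeasible_eq (s : ∀ i, S.SwSeq N i) (x : ∀ i, S.St i) :
    S.localFeasible N s x = S.stateFeasible N s x ∩
      ⋂ i, ⋂ k, (S.inputAt N i k).toAffineMap ⁻¹' S.U i := by
  have h : ∀ y : S.Glob N, ∀ i,
      ((S.stateAt N i 0).toAffineMap - AffineMap.const ℝ (S.Glob N) (x i) :
        S.Glob N →ᵃ[ℝ] S.St i) y = 0 ↔ (y i).1.1 0 = x i :=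
    fun y i => sub_eq_zero
  ext y
  simp only [localFeasible, stateFeasible, Set.mem_inter_iff, Set.mem_iInter, Set.mem_ofPred_eq,
    dynDefect_eq_zero, h, Yloc, Yseq]
  constructor
  · intro hy
    exact ⟨fun i => ⟨⟨(hy i).1.1, (hy i).2.2⟩, (hy i).2.1, (hy i).1.2.2.2⟩,
      fun i => (hy i).1.2.2.1⟩
  · rintro ⟨h1, h2⟩ i
    exact ⟨⟨(h1 i).1.1, fun k => Set.mem_iUnion.2 ⟨_, (h1 i).1.2 k⟩, h2 i, (h1 i).2.2⟩,
      (h1 i).2.1, (h1 i).1.2⟩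

theorem convex_localFeasible (s : ∀ i, S.SwSeq N i) (x : ∀ i, S.St i) :
    Convex ℝ (S.localFeasible N s x) := by
  rw [localFeasible_eq]
  exact (S.isPolyhedron_stateFeasible N s x).convex.inter
    (convex_iInter fun i => convex_iInter fun k => (S.U_convex i).affine_preimage _)

theorem isClosed_localFeasible (s : ∀ i, S.SwSeq N i) (x : ∀ i, S.St i) :
    IsClosed (S.localFeasible N s x) := by
  rw [localFeasible_eq]
  exact (S.isPolyhedron_stateFeasible N s x).isClosed.inter
    (isClosed_iInter fun i => isClosed_iInter fun k => (S.U_closed i).preimage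
      (LinearMap.continuous_of_finiteDimensional (S.inputAt N i k)))

theorem isPolyhedron_localFeasible (hU : ∀ i, IsPolytope (S.U i)) (s : ∀ i, S.SwSeq N i)
    (x : ∀ i, S.St i) : IsPolyhedron (S.localFeasible N s x) := by
  rw [localFeasible_eq]
  exact (S.isPolyhedron_stateFeasible N s x).inter
    (.iInter fun i => .iInter fun k => (hU i).isPolyhedron.preimage _)

theorem exists_norm_state_le : ∃ B, 0 ≤ B ∧ ∀ i l, ∀ p ∈ S.P i l, ‖p‖ ≤ B := by
  have h : ∀ i : Fin M, ∀ l, ∃ B, ∀ p ∈ S.P i l, ‖p‖ ≤ B := fun i l =>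
    (S.P_polytope i l).1.exists_norm_le
  choose B hB using h
  refine ⟨∑ i, ∑ l, |B i l|, by positivity, fun i l p hp => ?_⟩
  calc ‖p‖ ≤ |B i l| := (hB i l p hp).trans (le_abs_self _)
    _ ≤ ∑ l, |B i l| := Finset.single_le_sum (f := fun l => |B i l|)
        (fun _ _ => abs_nonneg _) (Finset.mem_univ l)
    _ ≤ _ := Finset.single_le_sum (f := fun i => ∑ l, |B i l|)
        (fun _ _ => by positivity) (Finset.mem_univ i)

theorem norm_state_le_norm_augEquiv (a : ∀ i, S.Aug N i) (i : Fin M) (k : Fin (N + 1)) :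
    ‖(a i).1 k‖ ≤ ‖S.augEquiv N a‖ := by
  have h1 := PiLp.norm_apply_le (S.augEquiv N a) i
  have h2 := PiLp.norm_apply_le ((S.augEquiv N a) i).fst k
  have h3 : ‖((S.augEquiv N a) i).fst‖ ≤ ‖(S.augEquiv N a) i‖ := WithLp.norm_fst_le _ _
  exact (h2.trans h3).trans h1

/-- Consistent trajectories close to a locally feasible point are bounded since the states are. -/
theorem exists_norm_consensus_le (s : ∀ i, S.SwSeq N i) (x : ∀ i, S.St i) (R : ℝ) :
    ∃ R' : ℝ, ∀ v ∈ S.localFeasible N s x, ∀ w ∈ S.consensus N, ‖S.augOf N v - w‖ ≤ R →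
      ‖w‖ ≤ R' := by
  obtain ⟨B, hB0, hB⟩ := S.exists_norm_state_le
  set T := LinearMap.toContinuousLinearMap (S.consistentAug N)
  refine ⟨‖T‖ * (B + R), ?_⟩
  rintro v hv _ ⟨z, rfl⟩ hR
  have hR0 : 0 ≤ R := (norm_nonneg _).trans hR
  refine T.le_opNorm_of_le ?_
  rw [pi_norm_le_iff_of_nonneg (by positivity)]
  intro i
  rw [pi_norm_le_iff_of_nonneg (by positivity)]
  intro k
  -- A consistent family is determined by its trajectories `z`, and each `z i k` is within `R` of a
  -- state in a bounded region; no bound on the copies is needed.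
  have h1 := S.norm_state_le_norm_augEquiv N ((fun i => (v i).1) - S.ztilde z) i k
  rw [map_sub, ← augOf_apply, ← consistentAug_apply] at h1
  have h2 : ‖(v i).1.1 k - z i k‖ ≤ R := h1.trans hR
  have h3 := hB i _ _ ((hv i).2.2 k)
  have h4 := norm_sub_le ((v i).1.1 k) ((v i).1.1 k - z i k)
  rw [sub_sub_cancel] at h4
  linarith

/-- Locally feasible points with bounded augmented trajectories are bounded if the inputs are. -/
theorem exists_norm_le_of_bounded_inputs (hU : ∀ i, Bornology.IsBounded (S.U i))
    (s : ∀ i, S.SwSeq N i) (x : ∀ i, S.St i) (R : ℝ) :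
    ∃ R' : ℝ, ∀ v ∈ S.localFeasible N s x, ‖S.augOf N v‖ ≤ R → ‖v‖ ≤ R' := by
  choose B hB using fun i => (hU i).exists_norm_le
  set T := LinearMap.toContinuousLinearMap (S.augEquiv N).symm.toLinearMap
  refine ⟨max (‖T‖ * R) (∑ i, |B i|), fun v hv hR => ?_⟩
  have hsum : 0 ≤ ∑ i, |B i| := by positivity
  have h0 : 0 ≤ max (‖T‖ * R) (∑ i, |B i|) := le_max_of_le_right hsum
  rw [pi_norm_le_iff_of_nonneg h0]
  intro i
  rw [Prod.norm_def]
  refine max_le_max ?_ ?_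
  · have h1 : T (S.augOf N v) = fun i => (v i).1 := (S.augEquiv N).symm_apply_apply _
    have h2 := T.le_opNorm_of_le hR
    rw [h1] at h2
    exact (norm_le_pi_norm (fun i => (v i).1) i).trans h2
  · rw [pi_norm_le_iff_of_nonneg hsum]
    intro k
    calc ‖(v i).2 k‖ ≤ |B i| := (hB i _ ((hv i).1.2.2.1 k)).trans (le_abs_self _)
      _ ≤ _ := Finset.single_le_sum (f := fun i => |B i|)
        (fun _ _ => abs_nonneg _) (Finset.mem_univ i)

theorem mem_Y_of_localFeasible {s : ∀ i, S.SwSeq N i} {x : ∀ i, S.St i} {v : S.Glob N}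
    (hv : v ∈ S.localFeasible N s x) (hc : S.Consistent v) : v ∈ S.Y N x :=
  ⟨fun i k => ⟨s i k.castSucc, (hv i).2.2 _, (hv i).2.1 k⟩, fun i => (hv i).1, hc⟩

/-! ### Reduction to ADMM and uniqueness of the inputs -/

/-- From the cut-off on, the procedure is a run of the alternating direction method of multipliers
for the convex problem defined by the final switching sequences. -/
theorem IsRun.admmRun {S : PWANetwork M} {N : ℕ} {ρ : ℝ} {Tcut : ℕ} {x : ∀ i, S.St i}
    {uhat : ∀ i, S.Inputs N i} {y : ℕ → S.Glob N} {z : ℕ → ∀ i, S.Traj N i}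
    {lam : ℕ → ∀ i, S.Aug N i} {s : ℕ → ∀ i, S.SwSeq N i}
    (h : S.IsRun ρ Tcut x uhat y z lam s) :
    ADMMRun (S.augOf N) (S.consensus N) (S.localFeasible N (s Tcut) x) (S.totalCost N) ρ
      (fun k => y (k + Tcut + 1)) (fun k => S.consistentAug N (z (k + Tcut)))
      (fun k => S.augEquiv N (lam (k + Tcut))) := by
  have hs : ∀ k, s (k + Tcut) = s Tcut := by
    intro k
    induction k with
    | zero => rw [zero_add]
    | succ k ih =>
      rw [add_right_comm, ← ih]
      exact funext fun i => h.s_cut _ (by omega) i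
  have hstep : ∀ τ, S.augEquiv N (lam (τ + 1)) = S.augEquiv N (lam τ) +
      ρ • (S.augOf N (y (τ + 1)) - S.consistentAug N (z (τ + 1))) := by
    intro τ
    rw [augOf_apply, consistentAug_apply, ← map_sub, ← map_smul, ← map_add]
    exact congrArg _ (funext fun i => h.lam_step τ i)
  -- This holds for all `τ`, whatever the switching: the start is zero and every update adds a
  -- multiple of a projection residual.
  have hlam : ∀ τ, S.augEquiv N (lam τ) ∈ (S.consensus N)ᗮ := by
    intro τ
    induction τ with
    | zero => rw [h.lam_init, map_zero]; exact Submodule.zero_mem _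
    | succ τ ih =>
      rw [hstep, h.z_step]
      exact Submodule.add_mem _ ih (Submodule.smul_mem _ _ (S.augOf_sub_average_mem N _))
  have hmem : ∀ k, y (k + Tcut + 1) ∈ S.localFeasible N (s Tcut) x := fun k i => by
    rw [← hs k]
    exact h.y_mem _ i
  refine ⟨hmem, fun k => ⟨_, rfl⟩, fun k => hlam _, fun k => ?_, fun k v hv => ?_⟩
  · have := hstep (k + Tcut)
    simpa only [add_right_comm k 1 Tcut] using this
  · refine (S.totalCost_convexOn N).le_add_inner_of_isMinOn (S.convex_localFeasible N (s Tcut) x)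
      (hmem k) (fun w hw => ?_) hv
    have hw' : ∀ i, w i ∈ S.Yloc N i (x i) ∩ S.Yseq i (s (k + Tcut) i) := by
      rw [hs k]
      exact hw
    have := Finset.sum_le_sum fun i (_ : i ∈ Finset.univ) =>
      isMinOn_iff.1 (h.y_min (k + Tcut) i) _ (hw' i)
    rwa [sum_augLagrangian, sum_augLagrangian] at this

/-- Locally feasible points with equal augmented trajectories that minimize the total cost for
these trajectories coincide if the stage costs are strictly convex in the inputs. -/
theorem eq_of_strictConvex_stage
    (hst : ∀ i, ∀ (ξ : S.St i) (w : ∀ j : S.Nb i, S.St j),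
      StrictConvexOn ℝ (S.U i) (fun v => S.stage i (ξ, v, w)))
    {s : ∀ i, S.SwSeq N i} {x : ∀ i, S.St i} {v w : S.Glob N}
    (hv : v ∈ S.localFeasible N s x) (hw : w ∈ S.localFeasible N s x)
    (haug : ∀ i, (v i).1 = (w i).1)
    (hmv : ∀ y ∈ S.localFeasible N s x, (∀ i, (y i).1 = (v i).1) →
      S.totalCost N v ≤ S.totalCost N y)
    (hmw : S.totalCost N w ≤ S.totalCost N v) : v = w := by
  -- The midpoint has the same trajectories and is locally feasible; if the inputs differed
  -- anywhere, it would cost strictly less than `v`.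
  set p : S.Glob N := (1 / 2 : ℝ) • v + (1 / 2 : ℝ) • w with hp
  have hpC : p ∈ S.localFeasible N s x :=
    S.convex_localFeasible N s x hv hw (by norm_num) (by norm_num) (by norm_num)
  have hp1 : ∀ i, (p i).1 = (v i).1 := fun i => by
    change (1 / 2 : ℝ) • (v i).1 + (1 / 2 : ℝ) • (w i).1 = (v i).1
    rw [← haug, ← add_smul]
    norm_num
  have hle := hmv p hpC hp1
  have hcost : ∀ y : S.Glob N, (∀ i, (y i).1 = (v i).1) → S.totalCost N y =
      ∑ i, ((∑ k : Fin N, S.stage i ((v i).1.1 k.castSucc, (y i).2 k,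
        fun j => (v i).1.2 j k.castSucc)) + S.Vf i ((v i).1.1 (Fin.last N))) := fun y hy => by
    simp only [totalCost, cost, hy]
  rw [hcost v fun _ => rfl, hcost w fun i => (haug i).symm] at hmw
  rw [hcost v fun _ => rfl, hcost p hp1] at hle
  by_contra hne
  obtain ⟨i₀, k₀, hk₀⟩ : ∃ i k, (v i).2 k ≠ (w i).2 k := by
    by_contra! hall
    exact hne (funext fun i => Prod.ext (haug i) (funext fun k => hall i k))
  have hterm : ∀ i k, S.stage i ((v i).1.1 (Fin.castSucc k), (p i).2 k,
      fun j => (v i).1.2 j k.castSucc) ≤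
      (1 / 2) * S.stage i ((v i).1.1 k.castSucc, (v i).2 k, fun j => (v i).1.2 j k.castSucc) +
      (1 / 2) * S.stage i ((v i).1.1 k.castSucc, (w i).2 k, fun j => (v i).1.2 j k.castSucc) :=
    fun i k => (hst i ((v i).1.1 k.castSucc) (fun j => (v i).1.2 j k.castSucc)).convexOn.2
      ((hv i).1.2.2.1 k) ((hw i).1.2.2.1 k) (by norm_num) (by norm_num) (by norm_num)
  have hstrict : S.stage i₀ ((v i₀).1.1 (Fin.castSucc k₀), (p i₀).2 k₀,
      fun j => (v i₀).1.2 j k₀.castSucc) <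
      (1 / 2) * S.stage i₀ ((v i₀).1.1 k₀.castSucc, (v i₀).2 k₀,
        fun j => (v i₀).1.2 j k₀.castSucc) +
      (1 / 2) * S.stage i₀ ((v i₀).1.1 k₀.castSucc, (w i₀).2 k₀,
        fun j => (v i₀).1.2 j k₀.castSucc) :=
    (hst i₀ ((v i₀).1.1 k₀.castSucc) (fun j => (v i₀).1.2 j k₀.castSucc)).2
      ((hv i₀).1.2.2.1 k₀) ((hw i₀).1.2.2.1 k₀) hk₀ (by norm_num) (by norm_num) (by norm_num)
  have hlt := Finset.sum_lt_sum (s := Finset.univ)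
    (fun i _ => Finset.sum_le_sum fun k (_ : k ∈ Finset.univ) => hterm i k)
    ⟨i₀, Finset.mem_univ _, Finset.sum_lt_sum (fun k _ => hterm i₀ k)
      ⟨k₀, Finset.mem_univ _, hstrict⟩⟩
  simp only [Finset.sum_add_distrib, ← Finset.mul_sum] at hlt hle hmw
  linarith

/-- With polytopic input constraint sets the convex problem defined by switching sequences has a
primal-dual solution if it is feasible. -/
theorem exists_isSaddle (hU : ∀ i, IsPolytope (S.U i)) {s : ∀ i, S.SwSeq N i} {x : ∀ i, S.St i}
    {v : S.Glob N} (hv : v ∈ S.localFeasible N s x) (hvV : S.augOf N v ∈ S.consensus N) :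
    ∃ y l, IsSaddle (S.augOf N) (S.consensus N) (S.localFeasible N s x) (S.totalCost N) y l := by
  have hFc := S.continuous_totalCost N
  have hQ : IsCompact (S.localFeasible N s x ∩ S.augOf N ⁻¹' S.consensus N) := by
    -- Radius `0` suffices: a consistent point has its own augmented trajectories in the consensus
    -- space.
    obtain ⟨R₁, hR₁⟩ := S.exists_norm_consensus_le N s x 0
    obtain ⟨R₂, hR₂⟩ := S.exists_norm_le_of_bounded_inputs N (fun i => (hU i).1) s x R₁
    refine Metric.isCompact_of_isClosed_isBounded
      ((S.isClosed_localFeasible N s x).inter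
        ((S.consensus N).closed_of_finiteDimensional.preimage (S.augOf N).continuous))
      (isBounded_iff_forall_norm_le.2 ⟨R₂, fun w hw => hR₂ w hw.1 ?_⟩)
    exact hR₁ w hw.1 _ hw.2 (by simp)
  obtain ⟨y, hy, hmin⟩ := hQ.exists_isMinOn ⟨v, hv, hvV⟩ hFc.continuousOn
  exact ⟨y, (S.isPolyhedron_localFeasible N hU s x).exists_isSaddle (S.totalCost_convexOn N) hFc
    hy.1 hy.2 hmin⟩

/-- Locally feasible sequences whose augmented trajectories approach a bounded sequence stay in a
compact set if the inputs are bounded. -/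
theorem exists_isCompact_of_bounded (hU : ∀ i, Bornology.IsBounded (S.U i))
    {s : ∀ i, S.SwSeq N i} {x : ∀ i, S.St i} {y : ℕ → S.Glob N} {z : ℕ → S.AugSpace N} {R : ℝ}
    (hy : ∀ k, y k ∈ S.localFeasible N s x) (hz : ∀ k, ‖z k‖ ≤ R)
    (h : Tendsto (fun k => S.augOf N (y k) - z k) atTop (𝓝 0)) :
    ∃ K : Set (S.Glob N), IsCompact K ∧ ∀ k, y k ∈ K := by
  obtain ⟨R₁, hR₁⟩ := h.norm.bddAbove_range
  obtain ⟨R', hR'⟩ := S.exists_norm_le_of_bounded_inputs N hU s x (R + R₁)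
  refine ⟨Metric.closedBall 0 R', isCompact_closedBall _ _, fun k => ?_⟩
  rw [mem_closedBall_zero_iff]
  refine hR' _ (hy k) ?_
  have h1 := norm_add_le (z k) (S.augOf N (y k) - z k)
  rw [add_sub_cancel] at h1
  exact h1.trans (add_le_add (hz k) (hR₁ ⟨k, rfl⟩))

end PWANetwork

end

/-! ### The proposition -/

theorem proposition2 {M : ℕ} (S : PWANetwork M) (N : ℕ)
    (hA : S.NoLocallyFeasibleTrap N)
    (x : ∀ i, S.St i) (hx : x ∈ S.X0 N)
    (uhat : ∀ i, S.Inputs N i)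
    (ρ : ℝ) (hρ : 0 < ρ) (Tcut : ℕ)
    (y : ℕ → S.Glob N) (z : ℕ → ∀ i, S.Traj N i) (lam : ℕ → ∀ i, S.Aug N i)
    (s : ℕ → ∀ i, S.SwSeq N i)
    (hw : S.WeaklyFeasible x uhat (s 0))
    (hrun : S.IsRun ρ Tcut x uhat y z lam s) :
    Tendsto (fun T => S.residual (y T)) atTop (𝓝 0) ∧
    (∀ ystar : S.Glob N, MapClusterPt ystar atTop y →
      S.residual ystar = 0 ∧ ystar ∈ S.Y N x) ∧
    ((∀ i, Bornology.IsBounded (S.U i)) →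
      Tendsto (fun T => Metric.infDist (y T) (S.Y N x)) atTop (𝓝 0)) ∧
    ((∀ i, IsPolytope (S.U i)) →
      ∃ ystar ∈ S.Y N x, S.residual ystar = 0 ∧
        (∀ i, Tendsto (fun T => (y T i).1) atTop (𝓝 (ystar i).1)) ∧
        ((∀ i, ∀ (ξ : S.St i) (w : ∀ j : S.Nb i, S.St j),
            StrictConvexOn ℝ (S.U i) (fun v => S.stage i (ξ, v, w))) →
          Tendsto y atTop (𝓝 ystar))) := by
  have hadmm := hrun.admmRun
  set C := S.localFeasible N (s Tcut) x
  -- The iterate `y (Tcut + 1)` shows that each local problem for `s Tcut` is feasible, so global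
  -- infeasibility would be a trap.
  obtain ⟨v, hv⟩ : (S.Ys (s Tcut) x).Nonempty := by
    by_contra hcon
    exact hA x hx ⟨s Tcut, Set.not_nonempty_iff_eq_empty.1 hcon, fun i =>
      ⟨_, hrun.y_mem Tcut i⟩⟩
  have hvC : v ∈ C := hv.1
  have hvV : S.augOf N v ∈ S.consensus N := (S.augOf_mem_consensus N).2 hv.2
  have hCc : IsClosed C := S.isClosed_localFeasible N _ _
  have hFc := S.continuous_totalCost N
  obtain ⟨⟨R, hR⟩, ha, hb⟩ := hadmm.tendsto_residual hρ
    (S.exists_norm_consensus_le N _ _) hvC hvV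
  have ha' := (tendsto_add_atTop_iff_nat (f := fun k =>
    S.consistentAug N (z (k + 1 + Tcut)) - S.consistentAug N (z (k + Tcut))) 1).1 ha
  have hshift : ∀ {X : Type} {f : ℕ → X} {l : Filter X},
      Tendsto (fun k => f (k + Tcut + 1)) atTop l → Tendsto f atTop l := fun {X f l} h =>
    (tendsto_add_atTop_iff_nat (Tcut + 1)).1 h
  have hmap : map (fun k => y (k + Tcut + 1)) atTop = map y atTop := by
    rw [show (fun k => y (k + Tcut + 1)) = y ∘ fun k => k + (Tcut + 1) from rfl, ← map_map,
      map_add_atTop_eq_nat]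
  have hres : Tendsto (fun T => S.residual (y T)) atTop (𝓝 0) :=
    hshift (S.tendsto_residual_zero N (fun k => ⟨_, rfl⟩) hb)
  have hcluster : ∀ ystar : S.Glob N, MapClusterPt ystar atTop y →
      ystar ∈ C ∧ S.residual ystar = 0 := by
    intro ystar hst
    have hst' : MapClusterPt ystar atTop fun k => y (k + Tcut + 1) := by
      rwa [MapClusterPt, hmap]
    constructor
    · exact isClosed_iff_clusterPt.1 hCc _ (ClusterPt.mono hst'
        (tendsto_principal.2 (.of_forall hadmm.mem)))
    · have h1 : MapClusterPt (S.residual ystar) atTop (S.residual ∘ y) :=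
        hst.continuousAt_comp (S.continuous_residual N).continuousAt
      exact eq_of_nhds_neBot (ClusterPt.mono h1 hres)
  have hclY : ∀ ystar : S.Glob N, MapClusterPt ystar atTop y →
      S.residual ystar = 0 ∧ ystar ∈ S.Y N x := fun ystar hst =>
    ⟨(hcluster _ hst).2, S.mem_Y_of_localFeasible N (hcluster _ hst).1
      ((S.residual_eq_zero N).1 (hcluster _ hst).2)⟩
  have hcompact : (∀ i, Bornology.IsBounded (S.U i)) →
      ∃ K : Set (S.Glob N), IsCompact K ∧ ∀ k, y (k + Tcut + 1) ∈ K := fun hU =>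
    S.exists_isCompact_of_bounded N hU hadmm.mem hR hb
  refine ⟨hres, hclY, fun hU => ?_, fun hU => ?_⟩
  · obtain ⟨K, hK, hyK⟩ := hcompact hU
    refine hshift (f := fun T => Metric.infDist (y T) (S.Y N x)) ?_
    -- By compactness every subsequence has a further one converging to a cluster point, which lies
    -- in `S.Y N x`.
    refine tendsto_of_subseq_tendsto fun ns hns => ?_
    obtain ⟨ys, -, φ, hφ, hlim⟩ := hK.tendsto_subseq fun k => hyK (ns k)
    refine ⟨φ, ?_⟩
    have hns' : Tendsto (fun k => ns (φ k) + Tcut + 1) atTop atTop :=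
      (tendsto_add_atTop_nat (Tcut + 1)).comp (hns.comp hφ.tendsto_atTop)
    have hys := hclY ys (MapClusterPt.of_comp hns' hlim.mapClusterPt)
    have h1 := ((Metric.continuous_infDist_pt (S.Y N x)).tendsto ys).comp hlim
    rwa [Metric.infDist_zero_of_mem hys.2] at h1
  · obtain ⟨K, hK, hyK⟩ := hcompact fun i => (hU i).1
    obtain ⟨y₀, l₀, hs₀⟩ := S.exists_isSaddle N hU hvC hvV
    obtain ⟨w, lw, hw, hπ, hlam⟩ := hadmm.exists_limit hρ hCc hFc ha' hb hK hyK hs₀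
    have haug : ∀ i, Tendsto (fun T => (y T i).1) atTop (𝓝 (w i).1) := fun i => by
      refine hshift (f := fun T => (y T i).1) ?_
      have h1 : Continuous (S.augEquiv N).symm :=
        LinearMap.continuous_of_finiteDimensional (S.augEquiv N).symm.toLinearMap
      exact (((continuous_apply i).comp h1).tendsto _).comp hπ
    have hwc : S.Consistent w := (S.augOf_mem_consensus N).1 hw.map_mem
    refine ⟨w, S.mem_Y_of_localFeasible N hw.mem hwc, (S.residual_eq_zero N).2 hwc, haug,
      fun hst => hshift (tendsto_of_subseq_tendsto fun ns hns => ?_)⟩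
    obtain ⟨w', -, φ, hφ, hlim⟩ := hK.tendsto_subseq fun k => hyK (ns k)
    have hns' := hns.comp hφ.tendsto_atTop
    have hw' := hadmm.isSaddle_of_tendsto hCc hFc
      ((S.consensus N).closed_of_finiteDimensional) ha' hb hns' hlim
      (hlam.comp ((tendsto_add_atTop_nat 1).comp hns'))
    have hπ' : S.augOf N w' = S.augOf N w :=
      tendsto_nhds_unique (((S.augOf N).continuous.tendsto _).comp hlim) (hπ.comp hns')
    have haug' : ∀ i, (w' i).1 = (w i).1 := fun i =>
      congrFun ((S.augEquiv N).injective hπ') i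
    -- Both are saddle points with the same augmented trajectories, so the multiplier terms cancel
    -- and each has minimal cost among points with those trajectories.
    have heq : w' = w := by
      refine S.eq_of_strictConvex_stage N hst hw'.mem hw.mem haug' (fun p hp hpw => ?_) ?_
      · have hπp : S.augOf N p = S.augOf N w' := by
          rw [PWANetwork.augOf_apply, PWANetwork.augOf_apply, funext hpw]
        have hopt := hw'.opt p hp
        rwa [hπp, sub_self, inner_zero_right, add_zero] at hopt
      · have hopt := hw.opt w' hw'.mem
        rwa [hπ', sub_self, inner_zero_right, add_zero] at hopt
    exact ⟨φ, heq ▸ hlim⟩
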